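/- For a composition $\mathbf k=(k_1,\dots,k_r)$ of positive integers and an integer $n\ge 0$ put $$\zeta_n(\mathbf k)=\sum_{n\ge n_1>\cdots>n_r>0}\frac{1}{n_1^{k_1}\cdots n_r^{k_r}},\qquad t^\star_n(\mathbf k)=\sum_{n\ge n_1\ge\cdots\ge n_r>0}\ \prod_{j=1}^r\frac{1}{(2n_j-1)^{k_j}},$$ where empty sums are $0$ and $\zeta_n(\emptyset)=t^\star_n(\emptyset)=1$, and let $a_d$ denote the sequence consisting of $d$ copies of $a$ (so $a_0=\emptyset$). For positive integers $N$ and $w$ let $\mathrm{CMZV}^N_w\subset\mathbb C$ be the $\mathbb Q$-span of all colored multiple zeta values of level $N$ and weight $w$, that is, of all $$\mathrm{Li}_{\mathbf k}(z_1,\dots,z_r)=\sum_{n_1>\cdots>n_r>0}\frac{z_1^{n_1}\cdots z_r^{n_r}}{n_1^{k_1}\cdots n_r^{k_r}} =\lim_{M\to\infty}\ \sum_{M\ge n_1>\cdots>n_r>0}\frac{z_1^{n_1}\cdots z_r^{n_r}}{n_1^{k_1}\cdots n_r^{k_r}}$$ with $r\ge1$, positive integers $k_1,\dots,k_r$ such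 that $k_1+\cdots+k_r=w$, $N$-th roots of unity $z_1,\dots,z_r$, and $(k_1,z_1)\ne(1,1)$. Then for all integers $p,k\ge 0$ and $m\ge 3$ the series below converges and $$\sum_{n\ge 0}\left[\frac{4^n}{\binom{2n}{n}}\right]^2\frac{t^\star_n(1_k)\,\zeta_n(2_p)}{(2n+1)^m}\in \mathrm{CMZV}^4_{m+2p+k}.$$ -/

import Mathlib

open Filter Topology

/-- The multiple harmonic sum
`ζ_n(k₁, …, k_r) = ∑_{n ≥ n₁ > ⋯ > n_r > 0} 1 / (n₁^k₁ ⋯ n_r^k_r)`, with `ζ_n(∅) = 1`.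
The outermost summation index is `n₁ = j + 1`. -/
noncomputable def multipleHarmonicSum : ℕ → List ℕ → ℝ
  | _, [] => 1
  | n, k :: ks =>
      ∑ j ∈ Finset.range n, 1 / ((j : ℝ) + 1) ^ k * multipleHarmonicSum j ks

/-- The multiple `t`-harmonic star sum
`t⋆_n(k₁, …, k_r) = ∑_{n ≥ n₁ ≥ ⋯ ≥ n_r > 0} 1 / ((2n₁ - 1)^k₁ ⋯ (2n_r - 1)^k_r)`, with
`t⋆_n(∅) = 1`. The outermost summation index is `n₁ = j + 1`, so that `2 n₁ - 1 = 2 j + 1`. -/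
noncomputable def multipleTHarmonicStarSum : ℕ → List ℕ → ℝ
  | _, [] => 1
  | n, k :: ks =>
      ∑ j ∈ Finset.range n, 1 / (2 * (j : ℝ) + 1) ^ k * multipleTHarmonicStarSum (j + 1) ks

/-- For the list of pairs `(k₁, z₁), …, (k_r, z_r)`, the truncated colored sum
`∑_{n ≥ n₁ > ⋯ > n_r > 0} (z₁^n₁ ⋯ z_r^n_r) / (n₁^k₁ ⋯ n_r^k_r)`.
The outermost summation index is `n₁ = j + 1`. -/
noncomputable def coloredHarmonicSum : ℕ → List (ℕ × ℂ) → ℂ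
  | _, [] => 1
  | n, (k, z) :: L =>
      ∑ j ∈ Finset.range n, z ^ (j + 1) / ((j : ℂ) + 1) ^ k * coloredHarmonicSum j L

/-- `IsColoredMZV N w ξ`: the number `ξ` is a colored multiple zeta value
`Li_{k₁, …, k_r}(z₁, …, z_r)` of level `N` and weight `w`. Here the `k_i` are positive integers
with sum `w`, the `z_i` are `N`-th roots of unity, `(k₁, z₁) ≠ (1, 1)`, and the (in general only
conditionally convergent) series is the limit of its truncations at `n₁ ≤ n`. -/
def IsColoredMZV (N w : ℕ) (ξ : ℂ) : Prop :=
  ∃ L : List (ℕ × ℂ),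
    (∀ q ∈ L, 0 < q.1 ∧ q.2 ^ N = 1) ∧
    L.head? ≠ some (1, 1) ∧
    (L.map Prod.fst).sum = w ∧
    Tendsto (fun n => coloredHarmonicSum n L) atTop (𝓝 ξ)

/-- `CMZV_w^N`, the `ℚ`-span in `ℂ` of all colored multiple zeta values of level `N` and
weight `w`. -/
noncomputable def CMZV (N w : ℕ) : Submodule ℚ ℂ :=
  Submodule.span ℚ {ξ : ℂ | IsColoredMZV N w ξ}

/-!
The series is an integral of multiple polylogarithms over the unit interval, and the substitution
`t = tan (φ / 2)` makes all differential forms in it rational with poles at `0`, `±1`, `±i`.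

Write `a_n = 4 ^ n / binom (2 n) n`. Integration by parts gives the moments
`∫ sin φ ^ (2 n + 1) (-log (cos φ)) ^ k / k! dφ = a_n t⋆_{n+1}(1_k) / (2 n + 1)` over `(0, π / 2)`
(`hasNewtonIntegral_moment`). Hence, with
`F_q(s) = ∑ a_n ζ_n(2_p) / (2 n + 1) ^ (q + 1) * s ^ (2 n + 1)` (`arcsinOdd`), termwise integration
of `F_{q+1}(sin φ) (-log (cos φ)) ^ k / k!` yields the series of the theorem with `m = q + 3` and
`t⋆_{n+1}` in place of `t⋆_n` (`exists_hasSum_star_succ`). The recursion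
`t⋆_n(1_{k+1}) = t⋆_{n+1}(1_{k+1}) - t⋆_{n+1}(1_k) / (2 n + 1)` then gives the series itself.

The functions `F_q(sin φ)` are reached from the constant `1` by repeated integration. The
recursions of the coefficients say that `cos φ F_0(sin φ)` has derivative
`arcsinEven p (sin φ)`, which is `1` for `p = 0` and otherwise has derivative
`4 cos φ F_0(sin φ)` with `p - 1` in place of `p`, and that `F_1` and `F_{q+2}` are
integrals of `F_0(sin φ) cot φ dφ = cos φ F_0(sin φ) dφ / sin φ` and of
`F_{q+1}(sin φ) cot φ dφ`. In the variable `t` the forms are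
`i dφ = i dt / (1 - i t) + i dt / (1 + i t)`, `dφ / sin φ = dt / t`,
`cot φ dφ = dt / t - 2 t dt / (1 + t²)` and `-d log (cos φ) = 4 t dt / (1 - t⁴)`. All are rational
combinations of `dt / t` and of `z dt / (1 - z t)` with `z ^ 4 = 1`, and these map
multiple polylogarithms of level four to such polylogarithms of weight one more
(`IsPolylogComb.geom`, `IsPolylogComb.div_self`). The form `i dφ` is used an even number of times
altogether, so that the coefficients remain rational.

The last form is `i dφ`, whose poles `±i` differ from `1`. So the truncated sums converge by
summation by parts, and Abel's theorem identifies their limit with the value of the integral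
(`exists_tendsto_coloredHarmonicSum`, `tendsto_polylog_one`).
-/

/-! ### Power series with polynomially bounded coefficients -/

/-- The sequence `c` grows at most polynomially. -/
def PolyBdd {𝕜 : Type*} [Norm 𝕜] (c : ℕ → 𝕜) : Prop :=
  ∃ (C : ℝ) (d : ℕ), ∀ n : ℕ, ‖c n‖ ≤ C * ((n : ℝ) + 1) ^ d

lemma summable_succ_pow_mul_geometric (d : ℕ) {ρ : ℝ} (h0 : 0 < ρ) (h1 : ρ < 1) :
    Summable fun n : ℕ => ((n : ℝ) + 1) ^ d * ρ ^ n := by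
  have h := (summable_nat_add_iff 1).2 (summable_pow_mul_geometric_of_norm_lt_one d
    (r := ρ) (by rwa [Real.norm_of_nonneg h0.le]))
  refine (h.mul_left ρ⁻¹).congr fun n => ?_
  push_cast
  rw [pow_succ]
  field_simp

lemma PolyBdd.nonneg {𝕜 : Type*} [SeminormedAddGroup 𝕜] {c : ℕ → 𝕜} (hc : PolyBdd c) :
    ∃ (C : ℝ) (d : ℕ), 0 ≤ C ∧ ∀ n : ℕ, ‖c n‖ ≤ C * ((n : ℝ) + 1) ^ d := by
  obtain ⟨C, d, h⟩ := hc
  exact ⟨C, d, by simpa using (norm_nonneg _).trans (h 0), h⟩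

lemma PolyBdd.mul {𝕜 : Type*} [NormedField 𝕜] {b c : ℕ → 𝕜} (hb : PolyBdd b) (hc : PolyBdd c) :
    PolyBdd fun n => b n * c n := by
  obtain ⟨B, e, hB, hb⟩ := hb.nonneg
  obtain ⟨C, d, hC, hc⟩ := hc.nonneg
  refine ⟨B * C, e + d, fun n => ?_⟩
  rw [norm_mul, pow_add]
  calc ‖b n‖ * ‖c n‖ ≤ (B * ((n : ℝ) + 1) ^ e) * (C * ((n : ℝ) + 1) ^ d) :=
        mul_le_mul (hb n) (hc n) (norm_nonneg _) (by positivity)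
    _ = _ := by ring

lemma PolyBdd.mono {𝕜 𝕜' : Type*} [Norm 𝕜] [Norm 𝕜'] {b : ℕ → 𝕜} {c : ℕ → 𝕜'} (hc : PolyBdd c)
    (h : ∀ n, ‖b n‖ ≤ ‖c n‖) : PolyBdd b := by
  obtain ⟨C, d, hc⟩ := hc
  exact ⟨C, d, fun n => (h n).trans (hc n)⟩

lemma PolyBdd.summable_norm {𝕜 : Type*} [NormedField 𝕜] {c : ℕ → 𝕜} (hc : PolyBdd c)
    {e : ℕ → ℕ} (he : ∀ n, n ≤ e n) {x : 𝕜} (hx : ‖x‖ < 1) :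
    Summable fun n => ‖c n * x ^ e n‖ := by
  obtain ⟨C, d, hC, h⟩ := hc.nonneg
  obtain ⟨ρ, hxρ, hρ⟩ := exists_between hx
  have h0 : 0 < ρ := (norm_nonneg x).trans_lt hxρ
  refine Summable.of_nonneg_of_le (fun n => norm_nonneg _) (fun n => ?_)
    ((summable_succ_pow_mul_geometric d h0 hρ).mul_left C)
  rw [norm_mul, norm_pow, ← mul_assoc]
  refine mul_le_mul (h n) ?_ (by positivity) (by positivity)
  exact (pow_le_pow_of_le_one (norm_nonneg x) hx.le (he n)).trans
    (pow_le_pow_left₀ (norm_nonneg x) hxρ.le n)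

lemma PolyBdd.summable {𝕜 : Type*} [NormedField 𝕜] [CompleteSpace 𝕜] {c : ℕ → 𝕜}
    (hc : PolyBdd c) {e : ℕ → ℕ} (he : ∀ n, n ≤ e n) {x : 𝕜} (hx : ‖x‖ < 1) :
    Summable fun n => c n * x ^ e n :=
  (hc.summable_norm he hx).of_norm

/-- Termwise differentiation of a power series whose exponents need not be consecutive. -/
lemma PolyBdd.hasDerivAt_tsum {𝕜 : Type*} [RCLike 𝕜] {c : ℕ → 𝕜} (hc : PolyBdd c)
    {e : ℕ → ℕ} (he : ∀ n, n ≤ e n) (he' : ∀ n, e n ≤ 2 * n + 2) {x : 𝕜} (hx : ‖x‖ < 1) :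
    HasDerivAt (fun y => ∑' n, c n * y ^ e n) (∑' n, c n * (e n * x ^ (e n - 1))) x := by
  obtain ⟨C, d, hC, h⟩ := hc.nonneg
  obtain ⟨ρ, hxρ, hρ⟩ := exists_between hx
  have h0 : 0 < ρ := (norm_nonneg x).trans_lt hxρ
  refine hasDerivAt_tsum_of_isPreconnected (t := Metric.ball (0 : 𝕜) ρ) (y₀ := x)
    (u := fun n : ℕ => (2 * C * ρ⁻¹) * (((n : ℝ) + 1) ^ (d + 1) * ρ ^ n))
    ((summable_succ_pow_mul_geometric (d + 1) h0 hρ).mul_left _) Metric.isOpen_ball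
    (convex_ball (0 : 𝕜) ρ).isPreconnected
    (fun n y _ => (hasDerivAt_pow (e n) y).const_mul (c n)) (fun n y hy => ?_)
    (by simpa using hxρ) (hc.summable he hx) (by simpa using hxρ)
  have hy' : ‖y‖ < ρ := by simpa using hy
  rw [norm_mul, norm_mul, norm_pow, RCLike.norm_natCast]
  have h1 : ‖y‖ ^ (e n - 1) ≤ ρ⁻¹ * ρ ^ n := by
    refine (pow_le_pow_left₀ (norm_nonneg y) hy'.le _).trans ?_
    calc ρ ^ (e n - 1) = ρ⁻¹ * ρ ^ (e n - 1 + 1) := by rw [pow_succ]; field_simp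
      _ ≤ ρ⁻¹ * ρ ^ n := mul_le_mul_of_nonneg_left
          (pow_le_pow_of_le_one h0.le hρ.le (by have := he n; omega)) (by positivity)
  have h2 : (e n : ℝ) ≤ 2 * ((n : ℝ) + 1) := by exact_mod_cast (he' n)
  calc ‖c n‖ * (e n * ‖y‖ ^ (e n - 1))
      ≤ (C * ((n : ℝ) + 1) ^ d) * ((2 * ((n : ℝ) + 1)) * (ρ⁻¹ * ρ ^ n)) := by
        gcongr
        exact h n
    _ = _ := by ring

/-- A generating function times `1 / (1 - x)` generates the partial sums. -/
lemma PolyBdd.tsum_partialSum {c b : ℕ → ℂ} (hc : PolyBdd c) (hb : PolyBdd b)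
    (hcb : ∀ n, b n = ∑ i ∈ Finset.range (n + 1), c i) {x : ℂ} (hx : ‖x‖ < 1) :
    (1 - x) * ∑' n, b n * x ^ n = ∑' n, c n * x ^ n := by
  have sb := hb.summable (e := fun n => n) (fun n => le_rfl) hx
  have sc := hc.summable (e := fun n => n) (fun n => le_rfl) hx
  have key : ∑' n, b n * x ^ n = x * ∑' n, b n * x ^ n + ∑' n, c n * x ^ n := by
    conv_lhs => rw [sb.tsum_eq_zero_add]
    rw [sc.tsum_eq_zero_add, ← tsum_mul_left]
    have hs : ∀ n, b (n + 1) * x ^ (n + 1) = x * (b n * x ^ n) + c (n + 1) * x ^ (n + 1) := by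
      intro n
      rw [hcb (n + 1), Finset.sum_range_succ, ← hcb n]
      ring
    rw [tsum_congr hs, (sb.mul_left x).tsum_add ((summable_nat_add_iff 1).2 sc)]
    have := hcb 0
    simp at this
    rw [this]; ring
  linear_combination key

/-! ### Multiple polylogarithms at colored words -/

/-- A word `(k₁, z₁), …, (k_r, z_r)` of positive exponents and `N`-th roots of unity. -/
def IsColoredWord (N : ℕ) (L : List (ℕ × ℂ)) : Prop :=
  ∀ q ∈ L, 0 < q.1 ∧ q.2 ^ N = 1

/-- The coefficients of the power series `∑ n, wordCoeff L n * t ^ n`, which is the multiple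
polylogarithm `Li_L` in one variable. For the empty word this is the constant series `1`, so that
`coloredHarmonicSum n L` is the sum of the coefficients of index at most `n` for every word. -/
noncomputable def wordCoeff : List (ℕ × ℂ) → ℕ → ℂ
  | [], n => if n = 0 then 1 else 0
  | _ :: _, 0 => 0
  | (k, z) :: L, n + 1 => z ^ (n + 1) / ((n : ℂ) + 1) ^ k * coloredHarmonicSum n L

/-- The multiple polylogarithm `∑ t^n₁ z₁^n₁ ⋯ z_r^n_r / (n₁^k₁ ⋯ n_r^k_r)` over
`n₁ > ⋯ > n_r > 0`. -/
noncomputable def polylog (L : List (ℕ × ℂ)) (t : ℝ) : ℂ :=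
  ∑' n, wordCoeff L n * (t : ℂ) ^ n

lemma coloredHarmonicSum_eq_sum (L : List (ℕ × ℂ)) (n : ℕ) :
    coloredHarmonicSum n L = ∑ i ∈ Finset.range (n + 1), wordCoeff L i := by
  cases L with
  | nil => simp [coloredHarmonicSum, wordCoeff]
  | cons q L =>
    obtain ⟨k, z⟩ := q
    rw [Finset.sum_range_succ']
    simp [coloredHarmonicSum, wordCoeff]

lemma sum_inv_sqrt_le (n : ℕ) :
    ∑ j ∈ Finset.range n, 1 / √((j : ℝ) + 1) ≤ 2 * √(n : ℝ) := by
  induction n with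
  | zero => simp
  | succ n ih =>
    rw [Finset.sum_range_succ]
    have h1 : 0 < √((n : ℝ) + 1) := by positivity
    have h2 : 1 / √((n : ℝ) + 1) ≤ 2 * (√((n : ℝ) + 1) - √n) := by
      rw [div_le_iff₀ h1]
      have e1 := Real.sq_sqrt (show (0 : ℝ) ≤ (n : ℝ) + 1 by positivity)
      have e2 := Real.sq_sqrt (show (0 : ℝ) ≤ (n : ℝ) by positivity)
      nlinarith [sq_nonneg (√((n : ℝ) + 1) - √n)]
    push_cast
    linarith

lemma norm_summand_le {k : ℕ} (hk : 0 < k) {z : ℂ} (hz : ‖z‖ = 1) (b : ℂ) (j : ℕ) :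
    ‖z ^ (j + 1) / ((j : ℂ) + 1) ^ k * b‖ ≤ ‖b‖ / ((j : ℝ) + 1) := by
  have e : ‖(j : ℂ) + 1‖ = (j : ℝ) + 1 := by
    rw [← Nat.cast_succ, Complex.norm_natCast, Nat.cast_succ]
  rw [norm_mul, norm_div, norm_pow, norm_pow, hz, one_pow, e, one_div, mul_comm, div_eq_mul_inv]
  refine mul_le_mul_of_nonneg_left ?_ (norm_nonneg b)
  exact inv_anti₀ (by positivity) (le_self_pow₀ (by linarith [Nat.cast_nonneg (α := ℝ) j]) hk.ne')

/-- Colored harmonic sums grow more slowly than any power of `n`; the exponent `1 / 2` is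
enough for the convergence arguments. -/
lemma norm_coloredHarmonicSum_le {N : ℕ} (hN : N ≠ 0) {L : List (ℕ × ℂ)}
    (hL : IsColoredWord N L) :
    ∃ C : ℝ, 0 ≤ C ∧ ∀ n, ‖coloredHarmonicSum n L‖ ≤ C * √((n : ℝ) + 1) := by
  induction L with
  | nil =>
    refine ⟨1, zero_le_one, fun n => ?_⟩
    simp [coloredHarmonicSum]
  | cons q L ih =>
    obtain ⟨k, z⟩ := q
    obtain ⟨C, hC, h⟩ := ih fun q hq => hL q (List.mem_cons_of_mem _ hq)
    obtain ⟨hk, hz⟩ := hL (k, z) List.mem_cons_self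
    refine ⟨2 * C, by positivity, fun n => ?_⟩
    rw [coloredHarmonicSum]
    calc ‖∑ j ∈ Finset.range n, z ^ (j + 1) / ((j : ℂ) + 1) ^ k * coloredHarmonicSum j L‖
        ≤ ∑ j ∈ Finset.range n, C * (1 / √((j : ℝ) + 1)) := by
          refine norm_sum_le_of_le _ fun j _ =>
            (norm_summand_le hk (Complex.norm_eq_one_of_pow_eq_one hz hN) _ j).trans ?_
          rw [div_le_iff₀ (by positivity)]
          refine (h j).trans (le_of_eq ?_)
          have h1 : 0 < √((j : ℝ) + 1) := by positivity
          have e1 := Real.mul_self_sqrt (show (0 : ℝ) ≤ (j : ℝ) + 1 by positivity)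
          field_simp
          rw [sq, e1]
      _ ≤ C * (2 * √(n : ℝ)) := by
          rw [← Finset.mul_sum]
          exact mul_le_mul_of_nonneg_left (sum_inv_sqrt_le n) hC
      _ ≤ 2 * C * √((n : ℝ) + 1) := by
          have : √(n : ℝ) ≤ √((n : ℝ) + 1) := Real.sqrt_le_sqrt (by linarith)
          nlinarith

lemma polyBdd_coloredHarmonicSum {N : ℕ} (hN : N ≠ 0) {L : List (ℕ × ℂ)}
    (hL : IsColoredWord N L) : PolyBdd fun n => coloredHarmonicSum n L := by
  obtain ⟨C, hC, h⟩ := norm_coloredHarmonicSum_le hN hL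
  refine ⟨C, 1, fun n => (h n).trans (mul_le_mul_of_nonneg_left ?_ hC)⟩
  rw [pow_one]
  exact Real.sqrt_le_iff.2 ⟨by positivity, by nlinarith [Nat.cast_nonneg (α := ℝ) n]⟩

lemma polyBdd_wordCoeff {N : ℕ} (hN : N ≠ 0) {L : List (ℕ × ℂ)} (hL : IsColoredWord N L) :
    PolyBdd (wordCoeff L) := by
  obtain ⟨C, d, hC, h⟩ := (polyBdd_coloredHarmonicSum hN hL).nonneg
  refine ⟨2 * C, d, fun n => ?_⟩
  have hn := h n
  rw [coloredHarmonicSum_eq_sum] at hn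
  cases n with
  | zero => simp at hn ⊢; linarith
  | succ n =>
    have hn' := h n
    rw [coloredHarmonicSum_eq_sum] at hn'
    have e : wordCoeff L (n + 1) = ∑ i ∈ Finset.range (n + 1 + 1), wordCoeff L i
        - ∑ i ∈ Finset.range (n + 1), wordCoeff L i := by
      rw [Finset.sum_range_succ]; ring
    rw [e]
    refine (norm_sub_le _ _).trans ?_
    have : C * ((n : ℝ) + 1) ^ d ≤ C * (((n + 1 : ℕ) : ℝ) + 1) ^ d := by
      gcongr
      linarith
    linarith

/-- Multiplying the first color by `y` multiplies the `n`-th coefficient by `y ^ n`. -/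
lemma exists_twisted_word {N : ℕ} {L : List (ℕ × ℂ)} (hL : IsColoredWord N L)
    {y : ℂ} (hy : y ^ N = 1) :
    ∃ M, IsColoredWord N M ∧ (M.map Prod.fst).sum = (L.map Prod.fst).sum ∧
      ∀ n, wordCoeff M n = y ^ n * wordCoeff L n := by
  cases L with
  | nil =>
    refine ⟨[], hL, rfl, fun n => ?_⟩
    rcases n with _ | n <;> simp [wordCoeff]
  | cons q L =>
    obtain ⟨k, z⟩ := q
    refine ⟨(k, y * z) :: L, ?_, rfl, fun n => ?_⟩
    · intro q hq
      obtain ⟨hk, hz⟩ := hL (k, z) List.mem_cons_self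
      rcases List.mem_cons.1 hq with rfl | hq
      · exact ⟨hk, by rw [mul_pow, hy, hz, one_mul]⟩
      · exact hL q (List.mem_cons_of_mem _ hq)
    · rcases n with _ | n
      · simp [wordCoeff]
      · simp only [wordCoeff, mul_pow]; ring

lemma norm_ofReal_lt_one {t : ℝ} (ht : t ∈ Set.Ioo (-1 : ℝ) 1) : ‖(t : ℂ)‖ < 1 := by
  rw [Complex.norm_real, Real.norm_eq_abs, abs_lt]; exact ht

lemma hasDerivAt_polylog {N : ℕ} (hN : N ≠ 0) {L : List (ℕ × ℂ)} (hL : IsColoredWord N L)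
    {t : ℝ} (ht : t ∈ Set.Ioo (-1 : ℝ) 1) :
    HasDerivAt (polylog L) (∑' n, wordCoeff L n * (n * (t : ℂ) ^ (n - 1))) t :=
  ((polyBdd_wordCoeff hN hL).hasDerivAt_tsum (e := fun n => n) (fun n => le_rfl)
    (fun n => by omega) (norm_ofReal_lt_one ht)).comp_ofReal

lemma polylog_cons_zero (q : ℕ × ℂ) (L : List (ℕ × ℂ)) : polylog (q :: L) 0 = 0 := by
  have : ∀ n, wordCoeff (q :: L) n * ((0 : ℝ) : ℂ) ^ n = 0 := by
    intro n
    rcases n with _ | n <;> simp [wordCoeff]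
  simp only [polylog, this, tsum_zero]

/-- Raising the first exponent is integration against `dt / t`. -/
lemma hasDerivAt_polylog_raise {N : ℕ} (hN : N ≠ 0) {k : ℕ} {z : ℂ} {L : List (ℕ × ℂ)}
    (hL : IsColoredWord N ((k, z) :: L)) {t : ℝ} (ht : t ∈ Set.Ioo (0 : ℝ) 1) :
    HasDerivAt (polylog ((k + 1, z) :: L)) (polylog ((k, z) :: L) t / t) t := by
  have hL' : IsColoredWord N ((k + 1, z) :: L) := by
    intro q hq
    rcases List.mem_cons.1 hq with rfl | hq
    · exact ⟨Nat.succ_pos k, (hL (k, z) List.mem_cons_self).2⟩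
    · exact hL q (List.mem_cons_of_mem _ hq)
  have ht0 : (t : ℂ) ≠ 0 := by exact_mod_cast ht.1.ne'
  convert hasDerivAt_polylog hN hL' ⟨by linarith [ht.1], ht.2⟩ using 1
  rw [polylog, div_eq_mul_inv, ← tsum_mul_right]
  refine tsum_congr fun n => ?_
  rcases n with _ | n
  · simp [wordCoeff]
  · have : (n : ℂ) + 1 ≠ 0 := Nat.cast_add_one_ne_zero n
    simp only [wordCoeff, Nat.add_sub_cancel]
    push_cast
    field_simp
    ring

/-- Prepending `(1, z)` is, up to a twist of the next color, integration against
`z dt / (1 - z t)`. -/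
lemma hasDerivAt_polylog_one_cons {N : ℕ} (hN : N ≠ 0) {z : ℂ} (hz : z ^ N = 1)
    {L M : List (ℕ × ℂ)} (hM : IsColoredWord N M)
    (hLM : ∀ n, wordCoeff L n = z ^ n * wordCoeff M n)
    {t : ℝ} (ht : t ∈ Set.Ioo (-1 : ℝ) 1) :
    HasDerivAt (polylog ((1, z) :: M)) (z / (1 - z * t) * polylog L t) t := by
  have hM' : IsColoredWord N ((1, z) :: M) := by
    intro q hq
    rcases List.mem_cons.1 hq with rfl | hq
    · exact ⟨one_pos, hz⟩
    · exact hM q hq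
  have hzt : ‖z * t‖ < 1 := by
    rw [norm_mul, Complex.norm_eq_one_of_pow_eq_one hz hN, one_mul]
    exact norm_ofReal_lt_one ht
  have hne : 1 - z * t ≠ 0 := by
    intro h
    rw [← sub_eq_zero.1 h, norm_one] at hzt
    exact lt_irrefl _ hzt
  convert hasDerivAt_polylog hN hM' ht using 1
  have e1 : polylog L t = ∑' n, wordCoeff M n * (z * t) ^ n := by
    refine tsum_congr fun n => ?_
    rw [hLM, mul_pow]; ring
  rw [e1, ← (polyBdd_wordCoeff hN hM).tsum_partialSum (polyBdd_coloredHarmonicSum hN hM)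
    (coloredHarmonicSum_eq_sum M) hzt]
  have hs : Summable fun n => wordCoeff ((1, z) :: M) n * (n * (t : ℂ) ^ (n - 1)) := by
    rw [← summable_nat_add_iff 1]
    have := ((polyBdd_coloredHarmonicSum hN hM).summable (e := fun n => n)
      (fun n => le_rfl) hzt).mul_left z
    refine this.congr fun n => ?_
    have : (n : ℂ) + 1 ≠ 0 := Nat.cast_add_one_ne_zero n
    simp only [wordCoeff, Nat.add_sub_cancel]
    push_cast
    field_simp
    ring
  rw [hs.tsum_eq_zero_add, ← mul_assoc, div_mul_cancel₀ _ hne, ← tsum_mul_left]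
  simp only [Nat.cast_zero, zero_mul, mul_zero, zero_add]
  refine tsum_congr fun n => ?_
  have : (n : ℂ) + 1 ≠ 0 := Nat.cast_add_one_ne_zero n
  simp only [wordCoeff, Nat.add_sub_cancel]
  push_cast
  field_simp
  ring

/-! ### Convergence at the end point -/

/-- Summation by parts, in the form of Dirichlet's test for the geometric sequence. -/
lemma one_sub_mul_sum (z : ℂ) (u : ℕ → ℂ) (n : ℕ) :
    (1 - z) * ∑ j ∈ Finset.range n, z ^ j * u j
      = u 0 - z ^ n * u n + ∑ j ∈ Finset.range n, z ^ (j + 1) * (u (j + 1) - u j) := by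
  induction n with
  | zero => simp
  | succ n ih =>
    rw [Finset.sum_range_succ, mul_add, ih, Finset.sum_range_succ]
    ring

lemma summable_sqrt_div_sq : Summable fun j : ℕ => √((j : ℝ) + 1) / ((j : ℝ) + 1) ^ 2 := by
  have := (summable_nat_add_iff 1).2
    (Real.summable_one_div_nat_rpow.2 (show (1 : ℝ) < 3 / 2 by norm_num))
  refine this.congr fun j => ?_
  have hj : (0 : ℝ) < (j : ℝ) + 1 := by positivity
  push_cast
  rw [Real.sqrt_eq_rpow, one_div, ← Real.rpow_neg hj.le, ← Real.rpow_natCast, ← Real.rpow_sub hj]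
  norm_num

lemma norm_wordCoeff_succ_le {N : ℕ} (hN : N ≠ 0) {L : List (ℕ × ℂ)} (hL : IsColoredWord N L) :
    ∃ C : ℝ, 0 ≤ C ∧ ∀ n : ℕ, ‖wordCoeff L (n + 1)‖ ≤ C * (√((n : ℝ) + 1) / ((n : ℝ) + 1)) := by
  cases L with
  | nil => exact ⟨0, le_rfl, fun n => by simp [wordCoeff]⟩
  | cons q L =>
    obtain ⟨k, z⟩ := q
    obtain ⟨hk, hz⟩ := hL (k, z) List.mem_cons_self
    obtain ⟨C, hC, h⟩ :=
      norm_coloredHarmonicSum_le hN (fun q hq => hL q (List.mem_cons_of_mem _ hq))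
    refine ⟨C, hC, fun n => ?_⟩
    rw [wordCoeff, ← mul_div_assoc]
    exact (norm_summand_le hk (Complex.norm_eq_one_of_pow_eq_one hz hN) _ n).trans
      (div_le_div_of_nonneg_right (h n) (by positivity))

/-- The truncations converge conditionally when the first letter is `(1, z)` with `z ≠ 1`. -/
lemma exists_tendsto_coloredHarmonicSum {N : ℕ} (hN : N ≠ 0) {z : ℂ} (hz : z ^ N = 1)
    (hz1 : z ≠ 1) {L : List (ℕ × ℂ)} (hL : IsColoredWord N L) :
    ∃ ξ, Tendsto (fun n => coloredHarmonicSum n ((1, z) :: L)) atTop (𝓝 ξ) := by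
  obtain ⟨C, hC, h⟩ := norm_coloredHarmonicSum_le hN hL
  have hzn := Complex.norm_eq_one_of_pow_eq_one hz hN
  have hcast : ∀ j : ℕ, ‖(j : ℂ) + 1‖ = (j : ℝ) + 1 := fun j => by
    rw [← Nat.cast_succ, Complex.norm_natCast, Nat.cast_succ]
  set u : ℕ → ℂ := fun j => coloredHarmonicSum j L / ((j : ℂ) + 1) with hu
  have hub : ∀ j, ‖u j‖ ≤ C * (1 / √((j : ℝ) + 1)) := by
    intro j
    rw [hu]
    simp only [norm_div, hcast]
    rw [div_le_iff₀ (by positivity)]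
    refine (h j).trans (le_of_eq ?_)
    have h1 : 0 < √((j : ℝ) + 1) := by positivity
    have e1 := Real.mul_self_sqrt (show (0 : ℝ) ≤ (j : ℝ) + 1 by positivity)
    field_simp
    rw [sq, e1]
  have hu0 : Tendsto (fun n => z ^ n * u n) atTop (𝓝 0) := by
    refine squeeze_zero_norm (a := fun n : ℕ => C * (1 / √((n : ℝ) + 1))) (fun n => ?_) ?_
    · rw [norm_mul, norm_pow, hzn, one_pow, one_mul]; exact hub n
    · have : Tendsto (fun n : ℕ => √((n : ℝ) + 1)) atTop atTop :=
        Real.tendsto_sqrt_atTop.comp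
          (tendsto_atTop_add_const_right _ _ tendsto_natCast_atTop_atTop)
      simpa using ((tendsto_const_nhds (x := (1 : ℝ))).div_atTop this).const_mul C
  obtain ⟨D, hD, hc⟩ := norm_wordCoeff_succ_le hN hL
  have hdiff : ∀ j, ‖u (j + 1) - u j‖ ≤ (C + D) * (√((j : ℝ) + 1) / ((j : ℝ) + 1) ^ 2) := by
    intro j
    have hb : coloredHarmonicSum (j + 1) L = coloredHarmonicSum j L + wordCoeff L (j + 1) := by
      rw [coloredHarmonicSum_eq_sum, Finset.sum_range_succ, ← coloredHarmonicSum_eq_sum]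
    have n1 : (j : ℂ) + 1 ≠ 0 := Nat.cast_add_one_ne_zero j
    have n2 : (j : ℂ) + 1 + 1 ≠ 0 := by exact_mod_cast Nat.succ_ne_zero (j + 1)
    have e : u (j + 1) - u j = wordCoeff L (j + 1) / ((j : ℂ) + 1 + 1)
        - coloredHarmonicSum j L / (((j : ℂ) + 1) * ((j : ℂ) + 1 + 1)) := by
      simp only [hu, hb]
      push_cast
      field_simp
      ring
    have hcast2 : ‖(j : ℂ) + 1 + 1‖ = (j : ℝ) + 1 + 1 := by exact_mod_cast hcast (j + 1)
    have hj : (0 : ℝ) < (j : ℝ) + 1 := by positivity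
    rw [e]
    refine (norm_sub_le _ _).trans ?_
    rw [norm_div, norm_div, norm_mul, hcast, hcast2, add_comm C D, add_mul D C]
    refine add_le_add ?_ ?_
    · calc ‖wordCoeff L (j + 1)‖ / ((j : ℝ) + 1 + 1)
          ≤ (D * (√((j : ℝ) + 1) / ((j : ℝ) + 1))) / ((j : ℝ) + 1) :=
            div_le_div₀ (by positivity) (hc j) hj (by linarith)
        _ = _ := by field_simp
    · calc ‖coloredHarmonicSum j L‖ / (((j : ℝ) + 1) * ((j : ℝ) + 1 + 1))
          ≤ (C * √((j : ℝ) + 1)) / (((j : ℝ) + 1) * ((j : ℝ) + 1)) :=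
            div_le_div₀ (by positivity) (h j) (by positivity) (by nlinarith)
        _ = _ := by field_simp
  have hsum : Summable fun j => z ^ (j + 1) * (u (j + 1) - u j) := by
    refine Summable.of_norm_bounded (summable_sqrt_div_sq.mul_left (C + D)) fun j => ?_
    rw [norm_mul, norm_pow, hzn, one_pow, one_mul]
    exact hdiff j
  have hz' : 1 - z ≠ 0 := sub_ne_zero.2 hz1.symm
  have hlim := (((tendsto_const_nhds (x := u 0)).sub hu0).add
    hsum.hasSum.tendsto_sum_nat).const_mul (z / (1 - z))
  refine ⟨_, hlim.congr fun n => ?_⟩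
  rw [← one_sub_mul_sum, coloredHarmonicSum, ← mul_assoc, div_mul_cancel₀ _ hz', Finset.mul_sum]
  refine Finset.sum_congr rfl fun j _ => ?_
  rw [hu, pow_one, pow_succ]
  ring

lemma tendsto_polylog_one {L : List (ℕ × ℂ)} {ξ : ℂ}
    (h : Tendsto (fun n => coloredHarmonicSum n L) atTop (𝓝 ξ)) :
    Tendsto (polylog L) (𝓝[<] 1) (𝓝 ξ) := by
  refine tendsto_map'_iff.1 (Complex.tendsto_tsum_powerSeries_nhdsWithin_lt
    ((tendsto_add_atTop_iff_nat 1).1 (h.congr fun n => coloredHarmonicSum_eq_sum L n)))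

/-! ### Rational combinations of polylogarithms and their primitives -/

/-- The `ℚ`-span of the multiple polylogarithms of level `N` and weight `w`, as functions. -/
noncomputable def polylogSpan (N w : ℕ) : Submodule ℚ (ℝ → ℂ) :=
  Submodule.span ℚ {h | ∃ L, IsColoredWord N L ∧ (L.map Prod.fst).sum = w ∧ h = polylog L}

/-- On `[0, 1)` the function `h` is a rational combination of multiple polylogarithms of level `N`
and weight `w`. -/
def IsPolylogComb (N w : ℕ) (h : ℝ → ℂ) : Prop :=
  ∃ g ∈ polylogSpan N w, Set.EqOn h g (Set.Ico 0 1)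

/-- On `(0, 1)` the function `d` is the derivative of a rational combination of multiple
polylogarithms of level `N` and weight `w + 1` that vanishes at `0`. -/
def IsPolylogDeriv (N w : ℕ) (d : ℝ → ℂ) : Prop :=
  ∃ g ∈ polylogSpan N (w + 1), g 0 = 0 ∧ ∀ t ∈ Set.Ioo (0 : ℝ) 1, HasDerivAt g (d t) t

/-- As `IsPolylogDeriv`, but such that the primitive also converges at `1`, to an element of
`CMZV N (w + 1)`. -/
def IsConvergentPolylogDeriv (N w : ℕ) (d : ℝ → ℂ) : Prop :=
  ∃ g ∈ polylogSpan N (w + 1), g 0 = 0 ∧ (∀ t ∈ Set.Ioo (0 : ℝ) 1, HasDerivAt g (d t) t) ∧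
    ∃ ξ ∈ CMZV N (w + 1), Tendsto g (𝓝[<] 1) (𝓝 ξ)

lemma continuousOn_of_mem_polylogSpan {N w : ℕ} (hN : N ≠ 0) {g : ℝ → ℂ}
    (hg : g ∈ polylogSpan N w) : ContinuousOn g (Set.Ico 0 1) := by
  induction hg using Submodule.span_induction with
  | mem x hx =>
    obtain ⟨L, hL, -, rfl⟩ := hx
    exact fun t ht => (hasDerivAt_polylog hN hL
      ⟨by linarith [ht.1], ht.2⟩).continuousAt.continuousWithinAt
  | zero => exact continuousOn_const
  | add x y _ _ hx hy => exact hx.add hy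
  | smul q x _ hx => exact hx.const_smul q

lemma hasDerivAt_ratSMul {g : ℝ → ℂ} {g' : ℂ} {t : ℝ} (q : ℚ) (h : HasDerivAt g g' t) :
    HasDerivAt (q • g) ((q : ℂ) * g') t := by
  have e : q • g = fun y => (q : ℂ) * g y := by
    funext y; rw [Pi.smul_apply, Rat.smul_def]
  rw [e]; exact h.const_mul _

lemma IsPolylogDeriv.add {N w : ℕ} {d e : ℝ → ℂ} (hd : IsPolylogDeriv N w d)
    (he : IsPolylogDeriv N w e) : IsPolylogDeriv N w fun t => d t + e t := by
  obtain ⟨g, hg, g0, hd⟩ := hd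
  obtain ⟨f, hf, f0, he⟩ := he
  exact ⟨g + f, add_mem hg hf, by simp [g0, f0], fun t ht => (hd t ht).add (he t ht)⟩

lemma IsPolylogDeriv.rat_mul {N w : ℕ} {d : ℝ → ℂ} (hd : IsPolylogDeriv N w d) (q : ℚ) :
    IsPolylogDeriv N w fun t => (q : ℂ) * d t := by
  obtain ⟨g, hg, g0, hd⟩ := hd
  exact ⟨q • g, Submodule.smul_mem _ _ hg, by simp [g0],
    fun t ht => hasDerivAt_ratSMul q (hd t ht)⟩

lemma IsPolylogDeriv.congr {N w : ℕ} {d e : ℝ → ℂ} (hd : IsPolylogDeriv N w d)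
    (h : ∀ t ∈ Set.Ioo (0 : ℝ) 1, d t = e t) : IsPolylogDeriv N w e := by
  obtain ⟨g, hg, g0, hd⟩ := hd
  exact ⟨g, hg, g0, fun t ht => h t ht ▸ hd t ht⟩

lemma IsConvergentPolylogDeriv.add {N w : ℕ} {d e : ℝ → ℂ} (hd : IsConvergentPolylogDeriv N w d)
    (he : IsConvergentPolylogDeriv N w e) : IsConvergentPolylogDeriv N w fun t => d t + e t := by
  obtain ⟨g, hg, g0, hd, ξ, hξ, lξ⟩ := hd
  obtain ⟨f, hf, f0, he, η, hη, lη⟩ := he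
  exact ⟨g + f, add_mem hg hf, by simp [g0, f0], fun t ht => (hd t ht).add (he t ht),
    ξ + η, add_mem hξ hη, lξ.add lη⟩

lemma IsConvergentPolylogDeriv.rat_mul {N w : ℕ} {d : ℝ → ℂ}
    (hd : IsConvergentPolylogDeriv N w d) (q : ℚ) :
    IsConvergentPolylogDeriv N w fun t => (q : ℂ) * d t := by
  obtain ⟨g, hg, g0, hd, ξ, hξ, lξ⟩ := hd
  exact ⟨q • g, Submodule.smul_mem _ _ hg, by simp [g0],
    fun t ht => hasDerivAt_ratSMul q (hd t ht), q • ξ, Submodule.smul_mem _ _ hξ,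
    lξ.const_smul q⟩

lemma IsConvergentPolylogDeriv.congr {N w : ℕ} {d e : ℝ → ℂ}
    (hd : IsConvergentPolylogDeriv N w d)
    (h : ∀ t ∈ Set.Ioo (0 : ℝ) 1, d t = e t) : IsConvergentPolylogDeriv N w e := by
  obtain ⟨g, hg, g0, hd, hξ⟩ := hd
  exact ⟨g, hg, g0, fun t ht => h t ht ▸ hd t ht, hξ⟩

/-- Integration against `z dt / (1 - z t)` raises the weight by one; the primitive converges at `1`
unless the form has its pole there. -/
lemma exists_primitive_geom {N w : ℕ} (hN : N ≠ 0) {z : ℂ} (hz : z ^ N = 1) {g : ℝ → ℂ}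
    (hg : g ∈ polylogSpan N w) :
    ∃ h ∈ polylogSpan N (w + 1), h 0 = 0 ∧
      (∀ t ∈ Set.Ioo (0 : ℝ) 1, HasDerivAt h (z / (1 - z * t) * g t) t) ∧
      (z ≠ 1 → ∃ ξ ∈ CMZV N (w + 1), Tendsto h (𝓝[<] 1) (𝓝 ξ)) := by
  induction hg using Submodule.span_induction with
  | mem x hx =>
    obtain ⟨L, hL, rfl, rfl⟩ := hx
    have hz0 : z ≠ 0 := by rintro rfl; simp [hN] at hz
    -- The twist by `z⁻¹` undoes the twist that prepending `(1, z)` produces.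
    obtain ⟨M, hM, hMw, hML⟩ := exists_twisted_word hL (y := z⁻¹) (by rw [inv_pow, hz, inv_one])
    have hM' : IsColoredWord N ((1, z) :: M) := by
      intro q hq
      rcases List.mem_cons.1 hq with rfl | hq
      · exact ⟨one_pos, hz⟩
      · exact hM q hq
    have hw : (((1, z) :: M).map Prod.fst).sum = (L.map Prod.fst).sum + 1 := by
      simp [hMw, add_comm]
    refine ⟨polylog ((1, z) :: M), Submodule.subset_span ⟨_, hM', hw, rfl⟩,
      polylog_cons_zero _ _, fun t ht => hasDerivAt_polylog_one_cons hN hz hM (fun n => ?_)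
        ⟨by linarith [ht.1], ht.2⟩, fun hz1 => ?_⟩
    · rw [hML, ← mul_assoc, ← mul_pow, mul_inv_cancel₀ hz0, one_pow, one_mul]
    · obtain ⟨ξ, hξ⟩ := exists_tendsto_coloredHarmonicSum hN hz hz1 hM
      exact ⟨ξ, Submodule.subset_span ⟨_, hM', by simp [hz1], hw, hξ⟩, tendsto_polylog_one hξ⟩
  | zero =>
    refine ⟨0, zero_mem _, rfl, fun t _ => ?_, fun _ => ⟨0, zero_mem _, tendsto_const_nhds⟩⟩
    simp
  | add x y _ _ hx hy =>
    obtain ⟨h, hh, h0, hd, hl⟩ := hx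
    obtain ⟨k, hk, k0, kd, kl⟩ := hy
    refine ⟨h + k, add_mem hh hk, by simp [h0, k0], fun t ht => ?_, fun hz1 => ?_⟩
    · rw [Pi.add_apply, mul_add]
      exact (hd t ht).add (kd t ht)
    · obtain ⟨ξ, hξ, lξ⟩ := hl hz1
      obtain ⟨η, hη, lη⟩ := kl hz1
      exact ⟨ξ + η, add_mem hξ hη, lξ.add lη⟩
  | smul q x _ hx =>
    obtain ⟨h, hh, h0, hd, hl⟩ := hx
    refine ⟨q • h, Submodule.smul_mem _ _ hh, by simp [h0], fun t ht => ?_, fun hz1 => ?_⟩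
    · rw [Pi.smul_apply, Rat.smul_def, mul_left_comm]
      exact hasDerivAt_ratSMul q (hd t ht)
    · obtain ⟨ξ, hξ, lξ⟩ := hl hz1
      exact ⟨q • ξ, Submodule.smul_mem _ _ hξ, lξ.const_smul q⟩

lemma IsPolylogComb.geom {N w : ℕ} (hN : N ≠ 0) {z : ℂ} (hz : z ^ N = 1) {h : ℝ → ℂ}
    (hh : IsPolylogComb N w h) : IsPolylogDeriv N w fun t => z / (1 - z * t) * h t := by
  obtain ⟨g, hg, e⟩ := hh
  obtain ⟨k, hk, k0, kd, -⟩ := exists_primitive_geom hN hz hg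
  exact ⟨k, hk, k0, fun t ht => by beta_reduce; rw [e ⟨ht.1.le, ht.2⟩]; exact kd t ht⟩

lemma IsPolylogComb.geom_convergent {N w : ℕ} (hN : N ≠ 0) {z : ℂ} (hz : z ^ N = 1)
    (hz1 : z ≠ 1) {h : ℝ → ℂ} (hh : IsPolylogComb N w h) :
    IsConvergentPolylogDeriv N w fun t => z / (1 - z * t) * h t := by
  obtain ⟨g, hg, e⟩ := hh
  obtain ⟨k, hk, k0, kd, kl⟩ := exists_primitive_geom hN hz hg
  exact ⟨k, hk, k0, fun t ht => by beta_reduce; rw [e ⟨ht.1.le, ht.2⟩]; exact kd t ht, kl hz1⟩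

/-- The form `dt / t` may be applied only in positive weight, where the integrand vanishes
at `0`. -/
lemma IsPolylogComb.div_self {N w : ℕ} (hN : N ≠ 0) {h : ℝ → ℂ}
    (hh : IsPolylogComb N (w + 1) h) : IsPolylogDeriv N (w + 1) fun t => h t / t := by
  obtain ⟨g, hg, e⟩ := hh
  suffices H : IsPolylogDeriv N (w + 1) fun t => g t / t from
    H.congr fun t ht => by rw [e ⟨ht.1.le, ht.2⟩]
  clear e
  induction hg using Submodule.span_induction with
  | mem x hx =>
    obtain ⟨L, hL, hw, rfl⟩ := hx
    cases L with
    | nil => simp at hw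
    | cons q L =>
      obtain ⟨k, z⟩ := q
      refine ⟨polylog ((k + 1, z) :: L), Submodule.subset_span ⟨_, ?_, ?_, rfl⟩,
        polylog_cons_zero _ _, fun t ht => hasDerivAt_polylog_raise hN hL ht⟩
      · intro q hq
        rcases List.mem_cons.1 hq with rfl | hq
        · exact ⟨Nat.succ_pos k, (hL (k, z) List.mem_cons_self).2⟩
        · exact hL q (List.mem_cons_of_mem _ hq)
      · simp at hw ⊢; omega
  | zero => exact ⟨0, zero_mem _, rfl, fun t _ => by simp⟩
  | add x y _ _ hx hy => exact (hx.add hy).congr fun t _ => by simp [add_div]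
  | smul q x _ hx =>
    exact (hx.rat_mul q).congr fun t _ => by rw [Pi.smul_apply, Rat.smul_def, mul_div_assoc]

lemma eqOn_of_hasDerivAt_eq {f g d : ℝ → ℂ} (hf : ContinuousOn f (Set.Ico 0 1))
    (hg : ContinuousOn g (Set.Ico 0 1)) (h0 : f 0 = g 0)
    (hfd : ∀ t ∈ Set.Ioo (0 : ℝ) 1, HasDerivAt f (d t) t)
    (hgd : ∀ t ∈ Set.Ioo (0 : ℝ) 1, HasDerivAt g (d t) t) :
    Set.EqOn f g (Set.Ico 0 1) := by
  intro t ht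
  rcases ht.1.eq_or_lt with rfl | ht0
  · exact h0
  have hsub : Set.Icc 0 t ⊆ Set.Ico (0 : ℝ) 1 := fun y hy => ⟨hy.1, hy.2.trans_lt ht.2⟩
  have hc : ContinuousOn (f - g) (Set.Icc 0 t) := (hf.sub hg).mono hsub
  have hd : ∀ y ∈ Set.Ioo 0 t, HasDerivAt (f - g) 0 y := fun y hy => by
    have := (hfd y ⟨hy.1, hy.2.trans ht.2⟩).sub (hgd y ⟨hy.1, hy.2.trans ht.2⟩)
    rwa [sub_self] at this
  have := intervalIntegral.integral_eq_sub_of_hasDerivAt_of_le ht.1 hc hd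
    intervalIntegrable_const
  simp only [intervalIntegral.integral_zero, Pi.sub_apply, h0, sub_self, sub_zero] at this
  exact sub_eq_zero.1 this.symm

/-- A function vanishing at `0` whose derivative comes from polylogarithms is itself a combination
of polylogarithms. -/
lemma IsPolylogDeriv.isPolylogComb {N w : ℕ} (hN : N ≠ 0) {h d : ℝ → ℂ}
    (hd : IsPolylogDeriv N w d) (hc : ContinuousOn h (Set.Ico 0 1)) (h0 : h 0 = 0)
    (hh : ∀ t ∈ Set.Ioo (0 : ℝ) 1, HasDerivAt h (d t) t) : IsPolylogComb N (w + 1) h := by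
  obtain ⟨g, hg, g0, hgd⟩ := hd
  exact ⟨g, hg, eqOn_of_hasDerivAt_eq hc (continuousOn_of_mem_polylogSpan hN hg)
    (h0.trans g0.symm) hh hgd⟩

lemma isPolylogComb_one (N : ℕ) : IsPolylogComb N 0 fun _ => 1 := by
  refine ⟨polylog [], Submodule.subset_span ⟨[], by simp [IsColoredWord], by simp, rfl⟩,
    fun t _ => ?_⟩
  simp only [polylog]
  rw [tsum_eq_single 0 fun n hn => by simp [wordCoeff, hn]]
  simp [wordCoeff]

/-! ### The forms of level four -/

lemma one_sub_I_mul_ne (t : ℝ) : 1 - Complex.I * t ≠ 0 := by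
  intro h
  have := congrArg Complex.re h
  simp at this

lemma one_add_I_mul_ne (t : ℝ) : 1 - -Complex.I * t ≠ 0 := by
  intro h
  have := congrArg Complex.re h
  simp at this

lemma one_add_sq_ne (t : ℝ) : 1 + (t : ℂ) ^ 2 ≠ 0 := by
  have : (1 : ℝ) + t ^ 2 ≠ 0 := by positivity
  exact_mod_cast this

lemma I_mem_roots : Complex.I ^ 4 = 1 := Complex.I_pow_four

lemma neg_I_mem_roots : (-Complex.I) ^ 4 = 1 := by
  rw [neg_pow, Complex.I_pow_four]; norm_num

lemma geom_I_sub (t : ℝ) :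
    Complex.I / (1 - Complex.I * t) - -Complex.I / (1 - -Complex.I * t)
      = Complex.I * (2 / (1 + (t : ℂ) ^ 2)) := by
  have h1 := one_sub_I_mul_ne t
  have h2 := one_add_I_mul_ne t
  have h3 := one_add_sq_ne t
  rw [div_sub_div _ _ h1 h2, mul_div_assoc', div_eq_div_iff (mul_ne_zero h1 h2) h3]
  ring_nf
  simp only [Complex.I_pow_three]
  ring

lemma geom_I_add (t : ℝ) :
    Complex.I / (1 - Complex.I * t) + -Complex.I / (1 - -Complex.I * t)
      = -(2 * t / (1 + (t : ℂ) ^ 2)) := by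
  have h1 := one_sub_I_mul_ne t
  have h2 := one_add_I_mul_ne t
  have h3 := one_add_sq_ne t
  rw [div_add_div _ _ h1 h2, ← neg_div, div_eq_div_iff (mul_ne_zero h1 h2) h3]
  ring_nf
  simp only [Complex.I_sq]
  ring

/-- The form `i dφ = 2 i dt / (1 + t²)`. -/
lemma IsPolylogComb.angle {w : ℕ} {h : ℝ → ℂ} (hh : IsPolylogComb 4 w h) :
    IsPolylogDeriv 4 w fun t => Complex.I * (2 / (1 + (t : ℂ) ^ 2)) * h t :=
  ((hh.geom four_ne_zero I_mem_roots).add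
    ((hh.geom four_ne_zero neg_I_mem_roots).rat_mul (-1))).congr fun t _ => by
      rw [← geom_I_sub]; push_cast; ring

/-- At `t = 1` the form `i dφ` leads to convergent values, since its poles `±i` are
different from `1`. -/
lemma IsPolylogComb.angle_convergent {w : ℕ} {h : ℝ → ℂ} (hh : IsPolylogComb 4 w h) :
    IsConvergentPolylogDeriv 4 w fun t => Complex.I * (2 / (1 + (t : ℂ) ^ 2)) * h t := by
  have n1 : Complex.I ≠ 1 := fun h => by simpa using congrArg Complex.re h
  have n2 : -Complex.I ≠ 1 := fun h => by simpa using congrArg Complex.re h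
  exact ((hh.geom_convergent four_ne_zero I_mem_roots n1).add
    ((hh.geom_convergent four_ne_zero neg_I_mem_roots n2).rat_mul (-1))).congr fun t _ => by
      rw [← geom_I_sub]; push_cast; ring

/-- The form `d log (1 + t²)`. -/
lemma IsPolylogComb.logOneAddSq {w : ℕ} {h : ℝ → ℂ} (hh : IsPolylogComb 4 w h) :
    IsPolylogDeriv 4 w fun t => 2 * t / (1 + (t : ℂ) ^ 2) * h t :=
  (((hh.geom four_ne_zero I_mem_roots).add
    (hh.geom four_ne_zero neg_I_mem_roots)).rat_mul (-1)).congr fun t _ => by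
      rw [← add_mul, geom_I_add]; push_cast; ring

/-- The form `d log (sin φ) = (1 - t²) / (t (1 + t²)) dt`. -/
lemma IsPolylogComb.logSin {w : ℕ} {h : ℝ → ℂ} (hh : IsPolylogComb 4 (w + 1) h) :
    IsPolylogDeriv 4 (w + 1) fun t => (1 - (t : ℂ) ^ 2) / (t * (1 + (t : ℂ) ^ 2)) * h t :=
  ((hh.div_self four_ne_zero).add (hh.logOneAddSq.rat_mul (-1))).congr fun t ht => by
    have h1 : (t : ℂ) ≠ 0 := by exact_mod_cast ht.1.ne'
    have h3 := one_add_sq_ne t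
    push_cast
    field_simp
    ring

/-- The form `-d log (cos φ) = 4 t / (1 - t⁴) dt`. -/
lemma IsPolylogComb.negLogCos {w : ℕ} {h : ℝ → ℂ} (hh : IsPolylogComb 4 w h) :
    IsPolylogDeriv 4 w fun t => 4 * t / ((1 + (t : ℂ) ^ 2) * (1 - (t : ℂ) ^ 2)) * h t :=
  (hh.logOneAddSq.add ((hh.geom four_ne_zero (one_pow 4)).add
    (hh.geom four_ne_zero (show (-1 : ℂ) ^ 4 = 1 by norm_num)))).congr fun t ht => by
    have h3 := one_add_sq_ne t
    have h4 : (1 : ℂ) - t ≠ 0 := by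
      have : (1 : ℝ) - t ≠ 0 := by linarith [ht.2]
      exact_mod_cast this
    have h5 : (1 : ℂ) + t ≠ 0 := by
      have : (1 : ℝ) + t ≠ 0 := by linarith [ht.1]
      exact_mod_cast this
    have h6 : (1 : ℂ) - (t : ℂ) ^ 2 = (1 - t) * (1 + t) := by ring
    rw [h6, one_mul, neg_one_mul, sub_neg_eq_add]
    field_simp
    ring

/-! ### Rational parametrization of the circle -/

/-- `sin φ` as a function of `t = tan (φ / 2)`. -/
noncomputable def halfSin (t : ℝ) : ℝ := 2 * t / (1 + t ^ 2)

/-- `cos φ` as a function of `t = tan (φ / 2)`. -/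
noncomputable def halfCos (t : ℝ) : ℝ := (1 - t ^ 2) / (1 + t ^ 2)

/-- The divided power `(-log (cos φ)) ^ k / k!` as a function of `t = tan (φ / 2)`. -/
noncomputable def logPow (k : ℕ) (t : ℝ) : ℝ := (-Real.log (halfCos t)) ^ k / (k.factorial : ℝ)

lemma halfSin_sq_add (t : ℝ) : halfSin t ^ 2 + halfCos t ^ 2 = 1 := by
  have : 1 + t ^ 2 ≠ 0 := by positivity
  rw [halfSin, halfCos]; field_simp; ring

lemma hasDerivAt_halfSin (t : ℝ) : HasDerivAt halfSin (2 / (1 + t ^ 2) * halfCos t) t := by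
  have h : 1 + t ^ 2 ≠ 0 := by positivity
  have := ((hasDerivAt_id t).const_mul 2).div ((hasDerivAt_pow 2 t).const_add 1) h
  refine this.congr_deriv ?_
  simp only [id, halfCos]
  field_simp
  norm_num
  ring

lemma hasDerivAt_halfCos (t : ℝ) : HasDerivAt halfCos (-(2 / (1 + t ^ 2) * halfSin t)) t := by
  have h : 1 + t ^ 2 ≠ 0 := by positivity
  have := ((hasDerivAt_pow 2 t).const_sub 1).div ((hasDerivAt_pow 2 t).const_add 1) h
  refine this.congr_deriv ?_
  simp only [halfSin]
  field_simp
  norm_num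
  ring

lemma halfCos_pos {t : ℝ} (ht : t ∈ Set.Ico (0 : ℝ) 1) : 0 < halfCos t :=
  div_pos (by nlinarith [ht.1, ht.2]) (by positivity)

lemma halfSin_nonneg {t : ℝ} (ht : 0 ≤ t) : 0 ≤ halfSin t := by
  rw [halfSin]; positivity

lemma halfSin_pos {t : ℝ} (ht : 0 < t) : 0 < halfSin t := by
  rw [halfSin]; positivity

lemma norm_halfSin_lt_one {t : ℝ} (ht : t ∈ Set.Ico (0 : ℝ) 1) : ‖halfSin t‖ < 1 := by
  rw [Real.norm_of_nonneg (halfSin_nonneg ht.1)]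
  nlinarith [halfSin_sq_add t, pow_pos (halfCos_pos ht) 2, halfSin_nonneg ht.1]

lemma halfCos_le_one (t : ℝ) : halfCos t ≤ 1 := by
  rw [halfCos, div_le_one (by positivity)]; nlinarith [sq_nonneg t]

lemma logPow_nonneg {k : ℕ} {t : ℝ} (ht : t ∈ Set.Ico (0 : ℝ) 1) : 0 ≤ logPow k t := by
  have := Real.log_nonpos (halfCos_pos ht).le (halfCos_le_one t)
  exact div_nonneg (pow_nonneg (by linarith) k) (Nat.cast_nonneg _)

lemma logPow_zero (t : ℝ) : logPow 0 t = 1 := by simp [logPow]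

lemma logPow_succ_at_zero (k : ℕ) : logPow (k + 1) 0 = 0 := by simp [logPow, halfCos]

lemma hasDerivAt_logPow (k : ℕ) {t : ℝ} (ht : t ∈ Set.Ico (0 : ℝ) 1) :
    HasDerivAt (logPow (k + 1)) (4 * t / ((1 + t ^ 2) * (1 - t ^ 2)) * logPow k t) t := by
  have hp := halfCos_pos ht
  have := ((((hasDerivAt_halfCos t).log hp.ne').neg).pow (k + 1)).div_const
    ((k + 1).factorial : ℝ)
  refine this.congr_deriv ?_
  have h1 : (1 : ℝ) + t ^ 2 ≠ 0 := by positivity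
  have h2 : (1 : ℝ) - t ^ 2 ≠ 0 := by nlinarith [ht.1, ht.2]
  have h3 : ((k + 1).factorial : ℝ) = ((k : ℝ) + 1) * k.factorial := by
    rw [Nat.factorial_succ]; push_cast; ring
  have h4 : (k.factorial : ℝ) ≠ 0 := by exact_mod_cast k.factorial_ne_zero
  have h5 : (k : ℝ) + 1 ≠ 0 := by positivity
  have e : -(-(2 / (1 + t ^ 2) * halfSin t) / halfCos t) = 4 * t / ((1 + t ^ 2) * (1 - t ^ 2)) := by
    rw [halfSin, halfCos]; field_simp; norm_num; ring
  rw [e, h3, logPow, Nat.add_sub_cancel, Pi.neg_apply]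
  push_cast
  field_simp

lemma continuousOn_logPow (k : ℕ) : ContinuousOn (logPow k) (Set.Ico 0 1) := by
  cases k with
  | zero => exact (continuousOn_const (c := (1 : ℝ))).congr fun t _ => logPow_zero t
  | succ k => exact fun t ht => (hasDerivAt_logPow k ht).continuousAt.continuousWithinAt

lemma hasDerivAt_logPow_ofReal (k : ℕ) {t : ℝ} (ht : t ∈ Set.Ico (0 : ℝ) 1) :
    HasDerivAt (fun y => (logPow (k + 1) y : ℂ))
      (4 * t / ((1 + (t : ℂ) ^ 2) * (1 - (t : ℂ) ^ 2)) * (logPow k t : ℂ)) t := by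
  simpa using (hasDerivAt_logPow k ht).ofReal_comp

lemma isPolylogComb_logPow (k : ℕ) : IsPolylogComb 4 k fun t => (logPow k t : ℂ) := by
  induction k with
  | zero =>
    obtain ⟨g, hg, e⟩ := isPolylogComb_one 4
    exact ⟨g, hg, fun t ht => by simpa [logPow_zero] using e ht⟩
  | succ k ih =>
    refine ih.negLogCos.isPolylogComb four_ne_zero
      (Complex.continuous_ofReal.comp_continuousOn (continuousOn_logPow (k + 1)))
      (by rw [logPow_succ_at_zero, Complex.ofReal_zero])
      fun t ht => hasDerivAt_logPow_ofReal k ⟨ht.1.le, ht.2⟩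

/-- If the derivative `d` of `h` stays a polylogarithmic integrand after multiplication with all
powers of `log (cos φ)`, then `h` times these powers is a combination of polylogarithms. This
replaces the shuffle product. -/
lemma isPolylogComb_mul_logPow {w : ℕ} {h d : ℝ → ℂ} (hc : ContinuousOn h (Set.Ico 0 1))
    (h0 : h 0 = 0) (hd : ∀ t ∈ Set.Ioo (0 : ℝ) 1, HasDerivAt h (d t) t)
    (H : ∀ k, IsPolylogDeriv 4 (w + k) fun t => d t * (logPow k t : ℂ)) (k : ℕ) :
    IsPolylogComb 4 (w + 1 + k) fun t => h t * (logPow k t : ℂ) := by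
  have hcl : ∀ k, ContinuousOn (fun t => h t * (logPow k t : ℂ)) (Set.Ico 0 1) := fun k =>
    hc.mul (Complex.continuous_ofReal.comp_continuousOn (continuousOn_logPow k))
  induction k with
  | zero =>
    refine (H 0).isPolylogComb four_ne_zero (hcl 0) (by rw [h0, zero_mul]) fun t ht => ?_
    simpa [logPow_zero] using hd t ht
  | succ k ih =>
    have ih' : IsPolylogComb 4 (w + (k + 1)) fun t => h t * (logPow k t : ℂ) := by
      rwa [show w + (k + 1) = w + 1 + k by ring]
    rw [show w + 1 + (k + 1) = w + (k + 1) + 1 by ring]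
    refine ((H (k + 1)).add ih'.negLogCos).isPolylogComb four_ne_zero (hcl (k + 1))
      (by rw [h0, zero_mul]) fun t ht => ?_
    refine ((hd t ht).mul (hasDerivAt_logPow_ofReal k ⟨ht.1.le, ht.2⟩)).congr_deriv ?_
    ring

/-! ### The arcsine series -/

/-- The number `4 ^ n / binom (2 n) n`. -/
noncomputable def centralRatio (n : ℕ) : ℝ := (4 : ℝ) ^ n / (Nat.choose (2 * n) n : ℝ)

/-- The multiple harmonic sum `ζ_n(2, …, 2)` with `p` arguments. -/
noncomputable def zetaTwo (p n : ℕ) : ℝ := multipleHarmonicSum n (List.replicate p 2)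

lemma centralRatio_zero : centralRatio 0 = 1 := by simp [centralRatio]

lemma centralRatio_succ (n : ℕ) :
    centralRatio (n + 1) * (2 * n + 1) = centralRatio n * (2 * n + 2) := by
  have h := Nat.succ_mul_centralBinom_succ n
  have h' : ((n : ℝ) + 1) * (Nat.choose (2 * (n + 1)) (n + 1) : ℝ)
      = 2 * (2 * n + 1) * (Nat.choose (2 * n) n : ℝ) := by
    rw [Nat.centralBinom_eq_two_mul_choose, Nat.centralBinom_eq_two_mul_choose] at h
    exact_mod_cast h
  have p1 : (Nat.choose (2 * (n + 1)) (n + 1) : ℝ) ≠ 0 := by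
    exact_mod_cast (Nat.choose_pos (by omega)).ne'
  have p2 : (Nat.choose (2 * n) n : ℝ) ≠ 0 := by
    exact_mod_cast (Nat.choose_pos (by omega)).ne'
  rw [centralRatio, centralRatio, div_mul_eq_mul_div, div_mul_eq_mul_div, div_eq_div_iff p1 p2,
    pow_succ]
  linear_combination (-(2 : ℝ) * 4 ^ n) * h'

lemma centralRatio_pos (n : ℕ) : 0 < centralRatio n := by
  have : 0 < Nat.choose (2 * n) n := Nat.choose_pos (by omega)
  rw [centralRatio]; positivity

lemma zetaTwo_zero (n : ℕ) : zetaTwo 0 n = 1 := by simp [zetaTwo, multipleHarmonicSum]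

lemma zetaTwo_succ_at_zero (p : ℕ) : zetaTwo (p + 1) 0 = 0 := by
  simp [zetaTwo, List.replicate_succ, multipleHarmonicSum]

lemma zetaTwo_succ_succ (p n : ℕ) :
    zetaTwo (p + 1) (n + 1) = zetaTwo (p + 1) n + 1 / ((n : ℝ) + 1) ^ 2 * zetaTwo p n := by
  simp only [zetaTwo, List.replicate_succ, multipleHarmonicSum, Finset.sum_range_succ]

lemma zetaTwo_nonneg (p n : ℕ) : 0 ≤ zetaTwo p n := by
  induction p generalizing n with
  | zero => rw [zetaTwo_zero]; exact zero_le_one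
  | succ p ih =>
    induction n with
    | zero => rw [zetaTwo_succ_at_zero]
    | succ n ihn => rw [zetaTwo_succ_succ]; have := ih n; positivity

lemma polyBdd_centralRatio : PolyBdd centralRatio := by
  refine ⟨1, 1, fun n => ?_⟩
  rw [Real.norm_of_nonneg (centralRatio_pos n).le, one_mul, pow_one]
  induction n with
  | zero => simp [centralRatio_zero]
  | succ n ih =>
    have h := centralRatio_succ n
    push_cast
    have hn : (0 : ℝ) ≤ n := Nat.cast_nonneg n
    have : centralRatio (n + 1) * (2 * n + 1) ≤ (n + 1 + 1) * (2 * n + 1) := by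
      rw [h]; nlinarith
    exact le_of_mul_le_mul_right this (by positivity)

lemma polyBdd_zetaTwo (p : ℕ) : PolyBdd (zetaTwo p) := by
  refine ⟨1, p, fun n => ?_⟩
  rw [Real.norm_of_nonneg (zetaTwo_nonneg p n), one_mul]
  induction p generalizing n with
  | zero => simp [zetaTwo_zero]
  | succ p ih =>
    induction n with
    | zero => rw [zetaTwo_succ_at_zero]; positivity
    | succ n ihn =>
      rw [zetaTwo_succ_succ]
      have h1 : 1 / ((n : ℝ) + 1) ^ 2 * zetaTwo p n ≤ 1 * ((n : ℝ) + 1) ^ p := by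
        refine mul_le_mul ?_ (ih n) (zetaTwo_nonneg p n) zero_le_one
        rw [div_le_one (by positivity)]
        nlinarith [Nat.cast_nonneg (α := ℝ) n]
      have h2 : ((n : ℝ) + 1) ^ p ≤ ((n : ℝ) + 1 + 1) ^ p := by gcongr; linarith
      have h3 : ((n : ℝ) + 1) ^ (p + 1) + ((n : ℝ) + 1) ^ p
          = ((n : ℝ) + 1 + 1) * ((n : ℝ) + 1) ^ p := by ring
      push_cast
      rw [pow_succ' ((n : ℝ) + 1 + 1)]
      nlinarith [Nat.cast_nonneg (α := ℝ) n]

/-- The coefficients `(4 ^ n / binom (2 n) n) ζ_n(2, …, 2) / (2 n + 1) ^ (q + 1)`. -/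
noncomputable def arcsinCoeff (p q n : ℕ) : ℝ :=
  centralRatio n * zetaTwo p n / (2 * (n : ℝ) + 1) ^ (q + 1)

/-- The odd series `∑ n, arcsinCoeff p q n * s ^ (2 n + 1)`. At `q = 0` and `s = sin φ` it equals
`4 ^ p φ ^ (2 p + 1) / ((2 p + 1)! cos φ)`. -/
noncomputable def arcsinOdd (p q : ℕ) (s : ℝ) : ℝ :=
  ∑' n, arcsinCoeff p q n * s ^ (2 * n + 1)

/-- The even companion of `arcsinOdd p 0`: at `s = sin φ` it equals `4 ^ p φ ^ (2 p) / (2 p)!`. -/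
noncomputable def arcsinEven : ℕ → ℝ → ℝ
  | 0, _ => 1
  | p + 1, s => ∑' n : ℕ, centralRatio (n + 1) * zetaTwo p n / ((n : ℝ) + 1) ^ 2 * s ^ (2 * n + 2)

lemma arcsinCoeff_nonneg (p q n : ℕ) : 0 ≤ arcsinCoeff p q n := by
  have := centralRatio_pos n
  have := zetaTwo_nonneg p n
  rw [arcsinCoeff]; positivity

lemma polyBdd_ratio_mul_zetaTwo (p : ℕ) : PolyBdd fun n => centralRatio n * zetaTwo p n :=
  polyBdd_centralRatio.mul (polyBdd_zetaTwo p)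

lemma polyBdd_arcsinCoeff (p q : ℕ) : PolyBdd (arcsinCoeff p q) := by
  refine (polyBdd_ratio_mul_zetaTwo p).mono fun n => ?_
  rw [arcsinCoeff, norm_div]
  refine div_le_self (norm_nonneg _) ?_
  rw [Real.norm_of_nonneg (by positivity)]
  exact one_le_pow₀ (by linarith [Nat.cast_nonneg (α := ℝ) n])

lemma centralRatio_succ_mul (p n : ℕ) : centralRatio (n + 1) * zetaTwo p n
    = centralRatio n * zetaTwo p n + arcsinCoeff p 0 n := by
  have h := centralRatio_succ n
  have : 2 * (n : ℝ) + 1 ≠ 0 := by positivity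
  rw [arcsinCoeff, zero_add, pow_one]
  field_simp
  linear_combination zetaTwo p n * h

lemma polyBdd_ratio_succ_mul_zetaTwo (p : ℕ) :
    PolyBdd fun n => centralRatio (n + 1) * zetaTwo p n := by
  have h2 : PolyBdd fun _ : ℕ => (2 : ℝ) := ⟨2, 0, fun n => by simp⟩
  refine (h2.mul (polyBdd_ratio_mul_zetaTwo p)).mono fun n => ?_
  have h1 : 0 ≤ centralRatio n * zetaTwo p n :=
    mul_nonneg (centralRatio_pos n).le (zetaTwo_nonneg p n)
  have h2 : arcsinCoeff p 0 n ≤ centralRatio n * zetaTwo p n := by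
    rw [arcsinCoeff, zero_add, pow_one]
    exact div_le_self h1 (by linarith [Nat.cast_nonneg (α := ℝ) n])
  rw [centralRatio_succ_mul, Real.norm_of_nonneg (add_nonneg h1 (arcsinCoeff_nonneg p 0 n)),
    Real.norm_of_nonneg (by positivity)]
  linarith

/-- The derivative of `arcsinOdd p q`. -/
lemma hasDerivAt_arcsinOdd (p q : ℕ) {s : ℝ} (hs : ‖s‖ < 1) :
    HasDerivAt (arcsinOdd p q)
      (∑' n : ℕ, centralRatio n * zetaTwo p n / (2 * (n : ℝ) + 1) ^ q * s ^ (2 * n)) s := by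
  refine ((polyBdd_arcsinCoeff p q).hasDerivAt_tsum (e := fun n => 2 * n + 1)
    (fun n => by omega) (fun n => by omega) hs).congr_deriv (tsum_congr fun n => ?_)
  have : 2 * (n : ℝ) + 1 ≠ 0 := by positivity
  rw [arcsinCoeff, Nat.add_sub_cancel, pow_succ]
  push_cast
  field_simp

lemma hasDerivAt_arcsinOdd_succ (p q : ℕ) {s : ℝ} (hs : ‖s‖ < 1) (hs0 : s ≠ 0) :
    HasDerivAt (arcsinOdd p (q + 1)) (arcsinOdd p q s / s) s := by
  refine (hasDerivAt_arcsinOdd p (q + 1) hs).congr_deriv ?_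
  rw [arcsinOdd, ← tsum_div_const]
  refine tsum_congr fun n => ?_
  rw [arcsinCoeff, pow_succ s]
  field_simp

lemma hasDerivAt_arcsinEven_succ (p : ℕ) {s : ℝ} (hs : ‖s‖ < 1) :
    HasDerivAt (arcsinEven (p + 1)) (4 * arcsinOdd p 0 s) s := by
  have hb : PolyBdd fun n : ℕ => centralRatio (n + 1) * zetaTwo p n / ((n : ℝ) + 1) ^ 2 := by
    refine (polyBdd_ratio_succ_mul_zetaTwo p).mono fun n => ?_
    rw [norm_div]
    refine div_le_self (norm_nonneg _) ?_
    rw [Real.norm_of_nonneg (by positivity)]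
    exact one_le_pow₀ (by linarith [Nat.cast_nonneg (α := ℝ) n])
  refine (hb.hasDerivAt_tsum (e := fun n => 2 * n + 2)
    (fun n => by omega) (fun n => by omega) hs).congr_deriv ?_
  rw [arcsinOdd, ← tsum_mul_left]
  refine tsum_congr fun n => ?_
  have h := centralRatio_succ n
  have h1 : 2 * (n : ℝ) + 1 ≠ 0 := by positivity
  have h2 : (n : ℝ) + 1 ≠ 0 := by positivity
  rw [arcsinCoeff, zero_add, pow_one, show 2 * n + 2 - 1 = 2 * n + 1 by omega]
  push_cast
  field_simp
  linear_combination (2 * zetaTwo p n * s ^ (2 * n + 1)) * h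

/-- The first order differential equation of `arcsinOdd p 0`. -/
lemma arcsinOdd_ode (p : ℕ) {s : ℝ} (hs : ‖s‖ < 1) :
    (1 - s ^ 2) * ∑' n : ℕ, centralRatio n * zetaTwo p n / (2 * (n : ℝ) + 1) ^ 0 * s ^ (2 * n)
      - s * arcsinOdd p 0 s = arcsinEven p s := by
  have s1 := (polyBdd_ratio_mul_zetaTwo p).summable (e := fun n => 2 * n) (fun n => by omega) hs
  have s2 := (polyBdd_arcsinCoeff p 0).summable (e := fun n => 2 * n + 1) (fun n => by omega) hs
  have e1 : s ^ 2 * ∑' n : ℕ, centralRatio n * zetaTwo p n * s ^ (2 * n) + s * arcsinOdd p 0 s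
      = ∑' n : ℕ, centralRatio (n + 1) * zetaTwo p n * s ^ (2 * n + 2) := by
    rw [arcsinOdd, ← tsum_mul_left, ← tsum_mul_left,
      ← (s1.mul_left (s ^ 2)).tsum_add (s2.mul_left s)]
    refine tsum_congr fun n => ?_
    rw [centralRatio_succ_mul]; ring
  simp only [pow_zero, div_one]
  suffices H : ∑' n : ℕ, centralRatio n * zetaTwo p n * s ^ (2 * n) = arcsinEven p s
      + ∑' n : ℕ, centralRatio (n + 1) * zetaTwo p n * s ^ (2 * n + 2) by
    linear_combination H - e1
  rw [s1.tsum_eq_zero_add]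
  cases p with
  | zero => simp [zetaTwo_zero, arcsinEven, centralRatio_zero, mul_add]
  | succ p =>
    have s3 := (polyBdd_ratio_succ_mul_zetaTwo (p + 1)).summable (e := fun n => 2 * n + 2)
      (fun n => by omega) hs
    have s4 : Summable fun n : ℕ =>
        centralRatio (n + 1) * zetaTwo p n / ((n : ℝ) + 1) ^ 2 * s ^ (2 * n + 2) := by
      refine (((summable_nat_add_iff 1).2 s1).sub s3).congr fun n => ?_
      rw [zetaTwo_succ_succ]; ring
    rw [arcsinEven, ← s4.tsum_add s3, zetaTwo_succ_at_zero]
    simp only [mul_zero, zero_mul, zero_add]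
    refine tsum_congr fun n => ?_
    rw [zetaTwo_succ_succ]; ring

/-! ### Arcsine series as polylogarithms -/

lemma hasDerivAt_arcsinEven_halfSin (p : ℕ) {t : ℝ} (ht : t ∈ Set.Ico (0 : ℝ) 1) :
    HasDerivAt (fun y => arcsinEven (p + 1) (halfSin y))
      (4 * (2 / (1 + t ^ 2)) * (halfCos t * arcsinOdd p 0 (halfSin t))) t := by
  refine ((hasDerivAt_arcsinEven_succ p (norm_halfSin_lt_one ht)).comp t
    (hasDerivAt_halfSin t)).congr_deriv ?_
  ring

lemma hasDerivAt_cos_mul_arcsinOdd (p : ℕ) {t : ℝ} (ht : t ∈ Set.Ico (0 : ℝ) 1) :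
    HasDerivAt (fun y => halfCos y * arcsinOdd p 0 (halfSin y))
      (2 / (1 + t ^ 2) * arcsinEven p (halfSin t)) t := by
  refine ((hasDerivAt_halfCos t).mul ((hasDerivAt_arcsinOdd p 0 (norm_halfSin_lt_one ht)).comp t
    (hasDerivAt_halfSin t))).congr_deriv ?_
  rw [← arcsinOdd_ode p (norm_halfSin_lt_one ht), Function.comp_apply]
  have h := halfSin_sq_add t
  rw [show 1 - halfSin t ^ 2 = halfCos t ^ 2 by linarith]
  ring

lemma hasDerivAt_arcsinOdd_one_halfSin (p : ℕ) {t : ℝ} (ht : t ∈ Set.Ioo (0 : ℝ) 1) :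
    HasDerivAt (fun y => arcsinOdd p 1 (halfSin y))
      (halfCos t * arcsinOdd p 0 (halfSin t) / t) t := by
  have ht' : t ∈ Set.Ico (0 : ℝ) 1 := ⟨ht.1.le, ht.2⟩
  refine ((hasDerivAt_arcsinOdd_succ p 0 (norm_halfSin_lt_one ht')
    (halfSin_pos ht.1).ne').comp t (hasDerivAt_halfSin t)).congr_deriv ?_
  have h1 : (1 : ℝ) + t ^ 2 ≠ 0 := by positivity
  have h2 := ht.1.ne'
  generalize arcsinOdd p 0 (halfSin t) = A
  rw [halfSin]
  field_simp

lemma hasDerivAt_arcsinOdd_halfSin (p q : ℕ) {t : ℝ} (ht : t ∈ Set.Ioo (0 : ℝ) 1) :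
    HasDerivAt (fun y => arcsinOdd p (q + 1) (halfSin y))
      ((1 - t ^ 2) / (t * (1 + t ^ 2)) * arcsinOdd p q (halfSin t)) t := by
  have ht' : t ∈ Set.Ico (0 : ℝ) 1 := ⟨ht.1.le, ht.2⟩
  refine ((hasDerivAt_arcsinOdd_succ p q (norm_halfSin_lt_one ht')
    (halfSin_pos ht.1).ne').comp t (hasDerivAt_halfSin t)).congr_deriv ?_
  have h1 : (1 : ℝ) + t ^ 2 ≠ 0 := by positivity
  have h2 := ht.1.ne'
  generalize arcsinOdd p q (halfSin t) = A
  rw [halfSin, halfCos]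
  field_simp

lemma continuousOn_arcsinOdd_halfSin (p q : ℕ) :
    ContinuousOn (fun y => arcsinOdd p q (halfSin y)) (Set.Ico 0 1) := fun t ht =>
  ((hasDerivAt_arcsinOdd p q (norm_halfSin_lt_one ht)).comp t
    (hasDerivAt_halfSin t)).continuousAt.continuousWithinAt

lemma halfSin_zero : halfSin 0 = 0 := by simp [halfSin]

lemma arcsinOdd_zero (p q : ℕ) : arcsinOdd p q 0 = 0 := by simp [arcsinOdd]

lemma arcsinEven_succ_zero (p : ℕ) : arcsinEven (p + 1) 0 = 0 := by simp [arcsinEven]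

/-- The form `dφ` carries a factor `i`, which is why `i` times the function, and not the function
itself, is a rational combination of polylogarithms. -/
lemma isPolylogComb_cos_mul_arcsinOdd (p : ℕ)
    (h : ∀ k, IsPolylogComb 4 (2 * p + k)
      fun t => (arcsinEven p (halfSin t) : ℂ) * (logPow k t : ℂ)) (k : ℕ) :
    IsPolylogComb 4 (2 * p + 1 + k) fun t =>
      Complex.I * ((halfCos t * arcsinOdd p 0 (halfSin t) : ℝ) : ℂ) * (logPow k t : ℂ) := by
  refine isPolylogComb_mul_logPow (d := fun t =>
      Complex.I * ((2 / (1 + t ^ 2) * arcsinEven p (halfSin t) : ℝ) : ℂ)) ?_ ?_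
    (fun t ht => ((hasDerivAt_cos_mul_arcsinOdd p ⟨ht.1.le, ht.2⟩).ofReal_comp).const_mul _)
    (fun k => (h k).angle.congr fun t _ => ?_) k
  · exact fun t ht => (((hasDerivAt_cos_mul_arcsinOdd p ht).ofReal_comp).const_mul
      Complex.I).continuousAt.continuousWithinAt
  · simp [halfSin_zero, arcsinOdd_zero]
  · push_cast; ring

lemma isPolylogComb_arcsinEven (p k : ℕ) : IsPolylogComb 4 (2 * p + k)
    fun t => (arcsinEven p (halfSin t) : ℂ) * (logPow k t : ℂ) := by
  induction p generalizing k with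
  | zero => simpa [arcsinEven] using isPolylogComb_logPow k
  | succ p ih =>
    refine isPolylogComb_mul_logPow (w := 2 * p + 1) (d := fun t =>
        ((4 * (2 / (1 + t ^ 2)) * (halfCos t * arcsinOdd p 0 (halfSin t)) : ℝ) : ℂ)) ?_ ?_
      (fun t ht => (hasDerivAt_arcsinEven_halfSin p ⟨ht.1.le, ht.2⟩).ofReal_comp)
      (fun k => ((isPolylogComb_cos_mul_arcsinOdd p ih k).angle.rat_mul (-4)).congr
        fun t _ => ?_) k
    · exact fun t ht => ((hasDerivAt_arcsinEven_halfSin p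
        ht).ofReal_comp).continuousAt.continuousWithinAt
    · simp [halfSin_zero, arcsinEven_succ_zero]
    · push_cast
      linear_combination (-4 * (2 / (1 + (t : ℂ) ^ 2)) * (halfCos t : ℂ) *
        (arcsinOdd p 0 (halfSin t) : ℂ) * (logPow k t : ℂ)) * Complex.I_sq

lemma isPolylogComb_arcsinOdd (p q k : ℕ) : IsPolylogComb 4 (2 * p + 2 + q + k)
    fun t => Complex.I * (arcsinOdd p (q + 1) (halfSin t) : ℂ) * (logPow k t : ℂ) := by
  have hc : ∀ q, ContinuousOn (fun t => Complex.I * (arcsinOdd p (q + 1) (halfSin t) : ℂ))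
      (Set.Ico 0 1) := fun q => continuousOn_const.mul
    (Complex.continuous_ofReal.comp_continuousOn (continuousOn_arcsinOdd_halfSin p (q + 1)))
  have h0 : ∀ q, Complex.I * (arcsinOdd p (q + 1) (halfSin 0) : ℂ) = 0 := fun q => by
    simp [halfSin_zero, arcsinOdd_zero]
  induction q generalizing k with
  | zero =>
    refine isPolylogComb_mul_logPow (w := 2 * p + 1) (hc 0) (h0 0) (fun t ht =>
      ((hasDerivAt_arcsinOdd_one_halfSin p ht).ofReal_comp).const_mul _) (fun k => ?_) k
    have := isPolylogComb_cos_mul_arcsinOdd p (isPolylogComb_arcsinEven p) k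
    rw [show 2 * p + 1 + k = 2 * p + k + 1 by ring] at this ⊢
    exact (this.div_self four_ne_zero).congr fun t _ => by push_cast; ring
  | succ q ih =>
    refine isPolylogComb_mul_logPow (w := 2 * p + 2 + q) (hc (q + 1)) (h0 (q + 1)) (fun t ht =>
      ((hasDerivAt_arcsinOdd_halfSin p (q + 1) ht).ofReal_comp).const_mul _) (fun k => ?_) k
    have := ih k
    rw [show 2 * p + 2 + q + k = 2 * p + 1 + q + k + 1 by ring] at this ⊢
    exact this.logSin.congr fun t _ => by push_cast; ring

/-! ### Integrals over the unit interval through primitives -/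

/-- The improper Newton integral of `R` over `(0, 1)` is `J`. -/
def HasNewtonIntegral (R : ℝ → ℝ) (J : ℝ) : Prop :=
  ∃ (f : ℝ → ℝ) (a b : ℝ), (∀ t ∈ Set.Ioo (0 : ℝ) 1, HasDerivAt f (R t) t) ∧
    Tendsto f (𝓝[>] 0) (𝓝 a) ∧ Tendsto f (𝓝[<] 1) (𝓝 b) ∧ b - a = J

lemma HasNewtonIntegral.add {R Q : ℝ → ℝ} {J K : ℝ} (hR : HasNewtonIntegral R J)
    (hQ : HasNewtonIntegral Q K) : HasNewtonIntegral (fun t => R t + Q t) (J + K) := by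
  obtain ⟨f, a, b, hd, ha, hb, rfl⟩ := hR
  obtain ⟨g, c, d, gd, gc, gb, rfl⟩ := hQ
  exact ⟨f + g, a + c, b + d, fun t ht => (hd t ht).add (gd t ht), ha.add gc, hb.add gb, by ring⟩

lemma HasNewtonIntegral.const_mul {R : ℝ → ℝ} {J : ℝ} (hR : HasNewtonIntegral R J) (c : ℝ) :
    HasNewtonIntegral (fun t => c * R t) (c * J) := by
  obtain ⟨f, a, b, hd, ha, hb, rfl⟩ := hR
  exact ⟨fun t => c * f t, c * a, c * b, fun t ht => (hd t ht).const_mul c, ha.const_mul c,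
    hb.const_mul c, by ring⟩

lemma HasNewtonIntegral.congr {R Q : ℝ → ℝ} {J K : ℝ} (hR : HasNewtonIntegral R J)
    (h : ∀ t ∈ Set.Ioo (0 : ℝ) 1, R t = Q t) (hJ : J = K) : HasNewtonIntegral Q K := by
  obtain ⟨f, a, b, hd, ha, hb, e⟩ := hR
  exact ⟨f, a, b, fun t ht => h t ht ▸ hd t ht, ha, hb, e.trans hJ⟩

/-- For nonnegative functions the Newton integral is a Lebesgue integral. -/
lemma HasNewtonIntegral.integral {R : ℝ → ℝ} {J : ℝ} (hR : HasNewtonIntegral R J)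
    (hnn : ∀ t ∈ Set.Ioo (0 : ℝ) 1, 0 ≤ R t) :
    MeasureTheory.IntegrableOn R (Set.Ioo 0 1) ∧ ∫ t in Set.Ioo (0 : ℝ) 1, R t = J := by
  obtain ⟨f, a, b, hd, ha, hb, rfl⟩ := hR
  have hcf : ContinuousOn f (Set.Ioo 0 1) :=
    fun t ht => (hd t ht).continuousAt.continuousWithinAt
  have hc := continuousOn_Icc_extendFrom_Ioo hcf ha hb
  have hd' : ∀ t ∈ Set.Ioo (0 : ℝ) 1, HasDerivAt (extendFrom (Set.Ioo 0 1) f) (R t) t := by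
    intro t ht
    refine (hd t ht).congr_of_eventuallyEq ?_
    filter_upwards [Ioo_mem_nhds ht.1 ht.2] with y hy
    exact extendFrom_eq (subset_closure hy) (hcf y hy)
  have hi := intervalIntegral.integrableOn_deriv_of_nonneg hc hd' hnn
  refine ⟨hi.mono_set Set.Ioo_subset_Ioc_self, ?_⟩
  rw [← MeasureTheory.integral_Ioc_eq_integral_Ioo, ← intervalIntegral.integral_of_le zero_le_one]
  exact intervalIntegral.integral_eq_sub_of_hasDerivAt_of_tendsto zero_lt_one hd
    ((intervalIntegrable_iff_integrableOn_Ioc_of_le zero_le_one).2 hi) ha hb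

/-! ### The sine moments of the powers of `log (cos φ)` -/

/-- The sum `t⋆_n(1, …, 1)` with `k` arguments. -/
noncomputable def tStarOnes (k n : ℕ) : ℝ := multipleTHarmonicStarSum n (List.replicate k 1)

lemma tStarOnes_zero (n : ℕ) : tStarOnes 0 n = 1 := by simp [tStarOnes, multipleTHarmonicStarSum]

lemma tStarOnes_succ_zero (k : ℕ) : tStarOnes (k + 1) 0 = 0 := by
  simp [tStarOnes, List.replicate_succ, multipleTHarmonicStarSum]

lemma tStarOnes_succ_succ (k n : ℕ) : tStarOnes (k + 1) (n + 1)
    = tStarOnes (k + 1) n + tStarOnes k (n + 1) / (2 * (n : ℝ) + 1) := by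
  simp only [tStarOnes, List.replicate_succ, multipleTHarmonicStarSum, Finset.sum_range_succ]
  ring

lemma tendsto_halfCos_one : Tendsto halfCos (𝓝[<] 1) (𝓝[>] 0) := by
  refine tendsto_nhdsWithin_iff.2 ⟨?_, ?_⟩
  · have := (hasDerivAt_halfCos 1).continuousAt.tendsto
    simp only [halfCos, one_pow, sub_self, zero_div] at this
    exact this.mono_left nhdsWithin_le_nhds
  · filter_upwards [Ioo_mem_nhdsLT (show (0 : ℝ) < 1 by norm_num)] with t ht
    exact halfCos_pos ⟨ht.1.le, ht.2⟩

lemma tendsto_mul_neg_log_pow (k : ℕ) :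
    Tendsto (fun x => x * (-Real.log x) ^ k) (𝓝[>] 0) (𝓝 0) := by
  have := (Real.tendsto_pow_mul_exp_neg_atTop_nhds_zero k).comp
    (tendsto_neg_atBot_atTop.comp Real.tendsto_log_nhdsGT_zero)
  refine this.congr' ?_
  filter_upwards [self_mem_nhdsWithin] with x hx
  simp only [Function.comp_apply, neg_neg]
  rw [Real.exp_log hx, mul_comm]

/-- Boundary terms of the integration by parts: `cos φ sin φ ^ (2 n) log (cos φ) ^ k` vanishes at
`φ = π / 2`, and also at `φ = 0` unless `n = k = 0`. -/
lemma tendsto_boundary (n k : ℕ) :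
    Tendsto (fun t => halfCos t * halfSin t ^ (2 * n) * logPow k t) (𝓝[<] 1) (𝓝 0) ∧
    Tendsto (fun t => halfCos t * halfSin t ^ (2 * n) * logPow k t) (𝓝[>] 0)
      (𝓝 (0 ^ (2 * n) * logPow k 0)) := by
  constructor
  · have h1 := ((tendsto_mul_neg_log_pow k).comp tendsto_halfCos_one).div_const
      (k.factorial : ℝ)
    have h2 : Tendsto (fun t => halfSin t ^ (2 * n)) (𝓝[<] 1) (𝓝 (halfSin 1 ^ (2 * n))) :=
      ((hasDerivAt_halfSin 1).continuousAt.tendsto.pow _).mono_left nhdsWithin_le_nhds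
    have := h1.mul h2
    rw [zero_div, zero_mul] at this
    refine this.congr fun t => ?_
    simp only [Function.comp_apply, logPow]
    ring
  · have h0 : halfCos 0 = 1 := by simp [halfCos]
    have hl : ContinuousAt (logPow k) 0 := by
      cases k with
      | zero =>
        exact (continuousAt_const (y := (1 : ℝ))).congr (.of_forall fun t => (logPow_zero t).symm)
      | succ k => exact (hasDerivAt_logPow k ⟨le_rfl, zero_lt_one⟩).continuousAt
    have := (((hasDerivAt_halfCos 0).continuousAt.tendsto.mul
      ((hasDerivAt_halfSin 0).continuousAt.tendsto.pow (2 * n))).mul hl.tendsto)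
    rw [h0, halfSin_zero, one_mul] at this
    exact this.mono_left nhdsWithin_le_nhds

/-- The integrand of the moment `∫ sin φ ^ (2 n + 1) (-log (cos φ)) ^ k / k! dφ` over
`(0, π / 2)`, in the variable `t = tan (φ / 2)`. -/
noncomputable def momentIntegrand (n k : ℕ) (t : ℝ) : ℝ :=
  2 / (1 + t ^ 2) * halfSin t ^ (2 * n + 1) * logPow k t

lemma hasDerivAt_cos_mul_sin_pow (n : ℕ) (t : ℝ) :
    HasDerivAt (fun y => halfCos y * halfSin y ^ (2 * n))
      (2 / (1 + t ^ 2) * (2 * n * halfSin t ^ (2 * n - 1)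
        - (2 * n + 1) * halfSin t ^ (2 * n + 1))) t := by
  refine ((hasDerivAt_halfCos t).mul ((hasDerivAt_halfSin t).pow (2 * n))).congr_deriv ?_
  have h := halfSin_sq_add t
  have hc : halfCos t ^ 2 = 1 - halfSin t ^ 2 := by linarith
  rcases n with _ | n
  · simp
  · rw [show 2 * (n + 1) - 1 = 2 * n + 1 by omega]
    simp only [Pi.pow_apply]
    push_cast
    linear_combination (2 / (1 + t ^ 2) * (2 * (n + 1)) * halfSin t ^ (2 * n + 1)) * hc

lemma momentIntegrand_boundary_zero (n : ℕ) : HasNewtonIntegral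
    (fun t => 2 / (1 + t ^ 2) * (2 * n * halfSin t ^ (2 * n - 1)
        - (2 * n + 1) * halfSin t ^ (2 * n + 1))) (-0 ^ (2 * n)) := by
  obtain ⟨h1, h0⟩ := tendsto_boundary n 0
  simp only [logPow_zero, mul_one] at h1 h0
  exact ⟨_, _, _, fun t _ => hasDerivAt_cos_mul_sin_pow n t, h0, h1, by ring⟩

lemma momentIntegrand_boundary_succ (n k : ℕ) : HasNewtonIntegral
    (fun t => 2 / (1 + t ^ 2) * (2 * n * halfSin t ^ (2 * n - 1)
        - (2 * n + 1) * halfSin t ^ (2 * n + 1)) * logPow (k + 1) t + momentIntegrand n k t) 0 := by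
  obtain ⟨h1, h0⟩ := tendsto_boundary n (k + 1)
  refine ⟨_, _, _, fun t ht => ((hasDerivAt_cos_mul_sin_pow n t).mul
    (hasDerivAt_logPow k ⟨ht.1.le, ht.2⟩)).congr_deriv ?_, h0, h1, ?_⟩
  · have e1 : (1 : ℝ) + t ^ 2 ≠ 0 := by positivity
    have e2 : (1 : ℝ) - t ^ 2 ≠ 0 := by nlinarith [ht.1, ht.2]
    have : halfCos t * (4 * t / ((1 + t ^ 2) * (1 - t ^ 2))) = 2 / (1 + t ^ 2) * halfSin t := by
      rw [halfCos, halfSin]; field_simp; ring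
    simp only [momentIntegrand]
    linear_combination (halfSin t ^ (2 * n) * logPow k t) * this
  · rw [logPow_succ_at_zero]; ring

/-- The moments, computed by integration by parts. -/
lemma hasNewtonIntegral_moment (k n : ℕ) : HasNewtonIntegral (momentIntegrand n k)
    (centralRatio n * tStarOnes k (n + 1) / (2 * (n : ℝ) + 1)) := by
  have hr : ∀ n : ℕ, 2 * (n : ℝ) + 1 ≠ 0 := fun n => by positivity
  have hr3 : ∀ n : ℕ, 2 * (n : ℝ) + 3 ≠ 0 := fun n => by positivity
  induction k generalizing n with
  | zero =>
    induction n with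
    | zero =>
      refine ((momentIntegrand_boundary_zero 0).const_mul (-1)).congr (fun t _ => ?_) ?_
      · simp [momentIntegrand, logPow_zero]
      · simp [centralRatio_zero, tStarOnes_zero]
    | succ n ih =>
      refine ((ih.const_mul (2 * n + 2)).add
        ((momentIntegrand_boundary_zero (n + 1)).const_mul (-1))).const_mul
          (1 / (2 * n + 3)) |>.congr (fun t _ => ?_) ?_
      · have := hr3 n
        rw [show 2 * (n + 1) - 1 = 2 * n + 1 by omega]
        simp only [momentIntegrand, logPow_zero]
        push_cast
        field_simp
        ring
      · have h := centralRatio_succ n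
        have := hr3 n
        have := hr n
        simp only [tStarOnes_zero]
        push_cast
        rw [zero_pow (by omega), show 2 * ((n : ℝ) + 1) + 1 = 2 * n + 3 by ring]
        field_simp
        linear_combination -h
  | succ k ihk =>
    induction n with
    | zero =>
      refine ((ihk 0).add ((momentIntegrand_boundary_succ 0 k).const_mul (-1))).congr
        (fun t _ => ?_) ?_
      · simp [momentIntegrand]
      · rw [tStarOnes_succ_succ, tStarOnes_succ_zero]; simp
    | succ n ih =>
      refine (((ih.const_mul (2 * n + 2)).add (ihk (n + 1))).add
        ((momentIntegrand_boundary_succ (n + 1) k).const_mul (-1))).const_mul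
          (1 / (2 * n + 3)) |>.congr (fun t _ => ?_) ?_
      · have := hr3 n
        rw [show 2 * (n + 1) - 1 = 2 * n + 1 by omega]
        simp only [momentIntegrand]
        push_cast
        field_simp
        ring
      · have h := centralRatio_succ n
        have := hr3 n
        have := hr n
        rw [tStarOnes_succ_succ k (n + 1)]
        push_cast
        rw [show 2 * ((n : ℝ) + 1) + 1 = 2 * n + 3 by ring]
        field_simp
        linear_combination (-(2 * n + 3) * tStarOnes (k + 1) (n + 1)) * h

/-! ### Summation of the series -/

lemma momentIntegrand_nonneg (n k : ℕ) {t : ℝ} (ht : t ∈ Set.Ioo (0 : ℝ) 1) :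
    0 ≤ momentIntegrand n k t := by
  have h1 := halfSin_nonneg ht.1.le
  have h2 := logPow_nonneg (k := k) ⟨ht.1.le, ht.2⟩
  rw [momentIntegrand]; positivity

/-- The integral of an arcsine series against a power of `log (cos φ)` is a colored
multiple zeta value of level four. -/
lemma exists_hasNewtonIntegral_arcsinOdd (p q k : ℕ) :
    ∃ J : ℝ, (J : ℂ) ∈ CMZV 4 (2 * p + 2 + q + k + 1) ∧
      HasNewtonIntegral
        (fun t => 2 / (1 + t ^ 2) * arcsinOdd p (q + 1) (halfSin t) * logPow k t) J := by
  obtain ⟨g, hg, g0, hd, ξ, hξ, lξ⟩ := (isPolylogComb_arcsinOdd p q k).angle_convergent.rat_mul (-1)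
  set R : ℝ → ℝ := fun t => 2 / (1 + t ^ 2) * arcsinOdd p (q + 1) (halfSin t) * logPow k t with hR
  have hd' : ∀ t ∈ Set.Ioo (0 : ℝ) 1, HasDerivAt g (R t : ℂ) t := fun t ht => by
    refine (hd t ht).congr_deriv ?_
    simp only [hR]
    push_cast
    linear_combination (-(2 / (1 + (t : ℂ) ^ 2)) * (arcsinOdd p (q + 1) (halfSin t) : ℂ) *
        (logPow k t : ℂ)) * Complex.I_sq
  have hgc := continuousOn_of_mem_polylogSpan four_ne_zero hg
  have hg0 : Tendsto g (𝓝[>] 0) (𝓝 0) := by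
    have := (hgc 0 ⟨le_rfl, zero_lt_one⟩).tendsto
    rw [g0] at this
    refine this.mono_left ?_
    rw [← nhdsWithin_Ioo_eq_nhdsGT (zero_lt_one' ℝ)]
    exact nhdsWithin_mono 0 Set.Ioo_subset_Ico_self
  -- The derivative is real, so `g` and its limit `ξ` are real.
  have him : ∀ t ∈ Set.Ico (0 : ℝ) 1, (g t).im = 0 := by
    intro t ht
    have hc : ContinuousOn (fun y => (g y).im) (Set.Icc 0 t) :=
      Complex.continuous_im.comp_continuousOn
        (hgc.mono fun y hy => ⟨hy.1, hy.2.trans_lt ht.2⟩)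
    have := intervalIntegral.integral_eq_sub_of_hasDerivAt_of_le ht.1 hc (f' := fun _ => 0)
      (fun y hy =>
        (Complex.imCLM.hasFDerivAt.comp_hasDerivAt y
          (hd' y ⟨hy.1, hy.2.trans ht.2⟩)).congr_deriv (by simp))
      intervalIntegrable_const
    simpa [g0] using this.symm
  have hξr : (ξ.re : ℂ) = ξ := by
    have h1 : Tendsto (fun t => (g t).im) (𝓝[<] 1) (𝓝 ξ.im) :=
      (Complex.continuous_im.tendsto ξ).comp lξ
    have h2 : Tendsto (fun t => (g t).im) (𝓝[<] 1) (𝓝 0) := by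
      refine tendsto_const_nhds.congr' ?_
      filter_upwards [Ioo_mem_nhdsLT (zero_lt_one' ℝ)] with t ht
      exact (him t ⟨ht.1.le, ht.2⟩).symm
    exact Complex.ext rfl (by simpa using (tendsto_nhds_unique h1 h2).symm)
  refine ⟨ξ.re, hξr ▸ hξ, fun t => (g t).re, 0, ξ.re, fun t ht => ?_, ?_,
    (Complex.continuous_re.tendsto ξ).comp lξ, sub_zero _⟩
  · exact (Complex.reCLM.hasFDerivAt.comp_hasDerivAt t (hd' t ht)).congr_deriv (by simp)
  · exact (Complex.continuous_re.tendsto 0).comp hg0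

/-- Termwise integration. All terms are nonnegative, so the integrability of the sum forces the
summability of the integrals. -/
lemma hasSum_newtonIntegral {F : ℕ → ℝ → ℝ} {R : ℝ → ℝ} {I : ℕ → ℝ} {J : ℝ}
    (hF : ∀ n, HasNewtonIntegral (F n) (I n)) (hR : HasNewtonIntegral R J)
    (hnn : ∀ n, ∀ t ∈ Set.Ioo (0 : ℝ) 1, 0 ≤ F n t)
    (hs : ∀ t ∈ Set.Ioo (0 : ℝ) 1, HasSum (fun n => F n t) (R t)) : HasSum I J := by
  have hFi := fun n => (hF n).integral (hnn n)
  obtain ⟨Ri, RJ⟩ := hR.integral fun t ht => (hs t ht).nonneg fun n => hnn n t ht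
  have hnorm : ∀ n, ∫ t in Set.Ioo (0 : ℝ) 1, ‖F n t‖ = I n := fun n => by
    rw [← (hFi n).2]
    exact MeasureTheory.setIntegral_congr_fun measurableSet_Ioo
      fun t ht => Real.norm_of_nonneg (hnn n t ht)
  have hI : ∀ n, 0 ≤ I n := fun n => by
    rw [← (hFi n).2]
    exact MeasureTheory.setIntegral_nonneg measurableSet_Ioo (hnn n)
  have hsum : Summable I := by
    refine summable_of_sum_range_le (c := J) hI fun N => ?_
    have e : ∑ n ∈ Finset.range N, I n
        = ∫ t in Set.Ioo (0 : ℝ) 1, ∑ n ∈ Finset.range N, F n t := by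
      rw [MeasureTheory.integral_finsetSum _ fun n _ => (hFi n).1]
      exact Finset.sum_congr rfl fun n _ => (hFi n).2.symm
    rw [e, ← RJ]
    refine MeasureTheory.setIntegral_mono_on
      (MeasureTheory.integrable_finsetSum _ fun n _ => (hFi n).1) Ri measurableSet_Ioo
      fun t ht => ?_
    exact sum_le_hasSum _ (fun n _ => hnn n t ht) (hs t ht)
  have := MeasureTheory.hasSum_integral_of_summable_integral_norm (F := F)
    (fun n => (hFi n).1) (by simpa only [hnorm] using hsum)
  simp only [(hFi _).2] at this
  rwa [MeasureTheory.setIntegral_congr_fun measurableSet_Ioo fun t ht => (hs t ht).tsum_eq,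
    RJ] at this

/-- The variant of the series with `t⋆_{n+1}` in place of `t⋆_n`: a single integral. -/
lemma exists_hasSum_star_succ (p q k : ℕ) :
    ∃ J : ℝ, (J : ℂ) ∈ CMZV 4 (2 * p + 2 + q + k + 1) ∧
      HasSum (fun n : ℕ => centralRatio n ^ 2 * (tStarOnes k (n + 1) * zetaTwo p n) /
        (2 * (n : ℝ) + 1) ^ (q + 3)) J := by
  obtain ⟨J, hJ, hR⟩ := exists_hasNewtonIntegral_arcsinOdd p q k
  refine ⟨J, hJ, ?_⟩
  have := hasSum_newtonIntegral
    (fun n => (hasNewtonIntegral_moment k n).const_mul (arcsinCoeff p (q + 1) n)) hR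
    (fun n t ht => mul_nonneg (arcsinCoeff_nonneg _ _ _) (momentIntegrand_nonneg n k ht))
    (fun t ht => ?_)
  · refine this.congr_fun fun n => ?_
    have : 2 * (n : ℝ) + 1 ≠ 0 := by positivity
    rw [arcsinCoeff]
    field_simp
    ring
  · have hs := ((polyBdd_arcsinCoeff p (q + 1)).summable (e := fun n => 2 * n + 1)
      (fun n => by omega) (norm_halfSin_lt_one ⟨ht.1.le, ht.2⟩)).hasSum
    refine ((hs.mul_left (2 / (1 + t ^ 2))).mul_right (logPow k t)).congr_fun fun n => ?_
    rw [momentIntegrand]; ring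

theorem mainTheorem11 (p k m : ℕ) (hm : 3 ≤ m) :
    ∃ S : ℝ,
      HasSum
        (fun n : ℕ =>
          ((4 : ℝ) ^ n / (Nat.choose (2 * n) n : ℝ)) ^ 2 *
            (multipleTHarmonicStarSum n (List.replicate k 1) *
              multipleHarmonicSum n (List.replicate p 2)) /
            (2 * (n : ℝ) + 1) ^ m) S ∧
      (S : ℂ) ∈ CMZV 4 (m + 2 * p + k) := by
  obtain ⟨q, rfl⟩ := Nat.exists_eq_add_of_le' hm
  change ∃ S : ℝ, HasSum (fun n : ℕ => centralRatio n ^ 2 * (tStarOnes k n * zetaTwo p n) /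
    (2 * (n : ℝ) + 1) ^ (q + 3)) S ∧ _
  obtain ⟨S, hS, hsum⟩ := exists_hasSum_star_succ p q k
  rw [show 2 * p + 2 + q + k + 1 = q + 3 + 2 * p + k by ring] at hS
  cases k with
  | zero => exact ⟨S, by simpa only [tStarOnes_zero] using hsum, hS⟩
  | succ k =>
    obtain ⟨T, hT, hsum'⟩ := exists_hasSum_star_succ p (q + 1) k
    rw [show 2 * p + 2 + (q + 1) + k + 1 = q + 3 + 2 * p + (k + 1) by ring] at hT
    refine ⟨S - T, (hsum.sub hsum').congr_fun fun n => ?_, ?_⟩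
    · have : 2 * (n : ℝ) + 1 ≠ 0 := by positivity
      rw [tStarOnes_succ_succ]
      field_simp
      ring
    · rw [Complex.ofReal_sub]; exact sub_mem hS hT
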